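/- Let $W(u)=\tfrac14(1-u^2)^2$, let $S^1=\mathbb R/\mathbb Z$, and for $\epsilon>0$, an open set $\Omega\subseteq S^1$ and $u\in W^{1,2}(S^1)$ put $$E_\epsilon(u;\Omega)=\int_\Omega \frac{\epsilon}{2}u_x^2+\frac1\epsilon W(u)\,dx .$$ For an open $\Omega\subset S^1$ whose boundary $Y$ is finite and separates $\Omega^+=\Omega$ from $\Omega^-=S^1\setminus\overline\Omega$, let $u^{\pm}$ be the minimizer of $E_\epsilon(\cdot\,;\Omega^\pm)$ among the $W^{1,2}$ functions vanishing on $Y$ that satisfies $\pm u^\pm>0$ on $\Omega^\pm$ (if it exists). Let $u_{\epsilon,Y}$ be the function equal to $u^\pm$ on $\Omega^\pm$ and to $0$ on $Y$ (the broken phase transition), and define the balanced energy $\mathrm{BE}_\epsilon(Y)=E_\epsilon(u_{\epsilon,Y};S^1)$. Let $p\ge 1$ be an integer. Then there is a function $v$ such that for every $0<\epsilon<\frac{1}{2p\pi}$ one has $v(\epsilon)<0$ and the following holds. 1. There is a unique function $u=u_{\epsilon,2p}$ on $S^1$ given by $u(\tfrac{i}{2p}+s)=(-1)^i u^+(s)$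 for $0\le i\le 2p-1$, $0\le s\le\frac1{2p}$, where $u^+$ is a positive minimizer of $E_\epsilon$ on $[0,\frac1{2p}]$ with zero boundary values. It is a $C^2$ solution of $\epsilon^2u_{xx}=W'(u)$ on $S^1$, its zero set is $Y_{2p}=\{\frac{i}{2p}:0\le i\le 2p-1\}$, and $c:=u_x(0)>0$. 2. Let $f$ be any real function on $Y_{2p}$ (so $f(1)=f(0)$), let $q_i(t)=\frac{i}{2p}+f(\frac{i}{2p})\,t$ for $0\le i\le 2p$, and let $Y_t=\{q_i(t):0\le i\le 2p-1\}\subset S^1$, with $\Omega^+_t$ the union of the arcs $(q_i(t),q_{i+1}(t))$ with $i$ even. Then for all $t$ near $0$ the broken phase transition of $Y_t$ exists and is unique, it equals $u_{\epsilon,2p}$ at $t=0$, the function $t\mapsto \mathrm{BE}_\epsilon(Y_t)$ is differentiable near $0$ and twice differentiable at $0$, and $$\mathrm{BE}_\epsilon''(f)\big|_{Y_{2p}}:=\frac{d^2}{dt^2}\Big|_{t=0}\mathrm{BE}_\epsilon(Y_t)=\epsilon\,c^2\,v(\epsilon)\sum_{i=0}^{2p-1}\Big[f\big(\tfrac{i}{2p}\big)-f\big(\tfrac{i+1}{2p}\big)\Big]^2\le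 0 .$$ Here $v(\epsilon)$ does not depend on $f$. -/

import Mathlib

open Set Filter Topology MeasureTheory

noncomputable section

namespace CircleAllenCahn

/-- The double-well potential `W(u) = (1 - u²)² / 4`. -/
def doubleWell (u : ℝ) : ℝ := (1 - u ^ 2) ^ 2 / 4

/-- The derivative `u_x` of a function on the circle `ℝ / ℤ`. -/
def circleDeriv (u : UnitAddCircle → ℝ) (x : UnitAddCircle) : ℝ :=
  deriv (fun s : ℝ => u (x + (s : UnitAddCircle))) 0

/-- The Sobolev space `W^{1,2}(ℝ / ℤ)` in its one-dimensional form: the functions that are the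
integral of their (almost everywhere) derivative, with this derivative in `L²`. -/
def IsW12 (u : UnitAddCircle → ℝ) : Prop :=
  MemLp (circleDeriv u) 2 volume ∧
    ∀ a b : ℝ, u (b : UnitAddCircle) - u (a : UnitAddCircle)
      = ∫ s in a..b, circleDeriv u (s : UnitAddCircle)

/-- Functions in `W^{1,2}` of an open set `Ω` that vanish on its boundary, extended by zero. -/
def IsW12Zero (Ω : Set UnitAddCircle) (u : UnitAddCircle → ℝ) : Prop :=
  IsW12 u ∧ ∀ x ∉ Ω, u x = 0

/-- The Allen-Cahn energy `E_ε(u; Ω)`. -/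
def energy (ε : ℝ) (u : UnitAddCircle → ℝ) (Ω : Set UnitAddCircle) : ℝ :=
  ∫ x in Ω, (ε / 2 * circleDeriv u x ^ 2 + 1 / ε * doubleWell (u x))

/-- `u` minimizes `E_ε(· ; Ω)` among the functions vanishing on the boundary of `Ω`. -/
def IsDirichletMinimizer (ε : ℝ) (Ω : Set UnitAddCircle) (u : UnitAddCircle → ℝ) : Prop :=
  IsW12Zero Ω u ∧ ∀ w, IsW12Zero Ω w → energy ε u Ω ≤ energy ε w Ω

/-- The pasted function: the positive minimizer on `Ω` and the negative minimizer on the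
complementary domain. -/
def IsBrokenPhaseTransition (ε : ℝ) (Ω : Set UnitAddCircle) (u : UnitAddCircle → ℝ) : Prop :=
  ∃ uPos uNeg : UnitAddCircle → ℝ,
    (IsDirichletMinimizer ε Ω uPos ∧ ∀ x ∈ Ω, 0 < uPos x) ∧
    (IsDirichletMinimizer ε (closure Ω)ᶜ uNeg ∧ ∀ x ∈ (closure Ω)ᶜ, uNeg x < 0) ∧
    (∀ x ∈ closure Ω, u x = uPos x) ∧ (∀ x ∈ (closure Ω)ᶜ, u x = uNeg x)

open Classical in
/-- The broken phase transition of `Ω` (the zero function if there is none). -/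
def brokenPhaseTransition (ε : ℝ) (Ω : Set UnitAddCircle) : UnitAddCircle → ℝ :=
  if h : ∃ u, IsBrokenPhaseTransition ε Ω u then h.choose else 0

/-- The balanced energy of (the boundary of) `Ω`. -/
def balancedEnergy (ε : ℝ) (Ω : Set UnitAddCircle) : ℝ :=
  energy ε (brokenPhaseTransition ε Ω) univ

/-- The open arc of the circle covered by the interval `(a, b)`. -/
def arc (a b : ℝ) : Set UnitAddCircle :=
  (fun s : ℝ => (s : UnitAddCircle)) '' Ioo a b

/-- The point `i / (2p)` as a real number. -/
def node (p i : ℕ) : ℝ := (i : ℝ) / (2 * (p : ℝ))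

/-- The set `{i / (2p) : 0 ≤ i ≤ 2p - 1}` on the circle. -/
def nodeSet (p : ℕ) : Set UnitAddCircle :=
  {x | ∃ i < 2 * p, x = (node p i : UnitAddCircle)}

/-- The moving node `i / (2p) + f(i / (2p)) t`. Since `f` is a function on the circle, the node
of index `2p` is the node of index `0` plus one full turn. -/
def movingNode (p : ℕ) (f : UnitAddCircle → ℝ) (t : ℝ) (i : ℕ) : ℝ :=
  node p i + f (node p i : UnitAddCircle) * t

/-- The positive side of the moving nodes: the union of the arcs from a node of even index to the
next node. -/
def movingDomain (p : ℕ) (f : UnitAddCircle → ℝ) (t : ℝ) : Set UnitAddCircle :=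
  ⋃ j ∈ Finset.range p, arc (movingNode p f t (2 * j)) (movingNode p f t (2 * j + 1))

/-- The function obtained from the positive minimizer on `[0, 1 / (2p)]` by repeating it with
alternating signs on the intervals `[i / (2p), (i + 1) / (2p)]`. -/
def IsSymmetricTransition (ε : ℝ) (p : ℕ) (u : UnitAddCircle → ℝ) : Prop :=
  ∃ w : UnitAddCircle → ℝ,
    (IsDirichletMinimizer ε (arc 0 (node p 1)) w ∧ ∀ x ∈ arc 0 (node p 1), 0 < w x) ∧
    ∀ i < 2 * p, ∀ s ∈ Icc 0 (node p 1),
      u ((node p i + s : ℝ) : UnitAddCircle) = (-1) ^ i * w (s : UnitAddCircle)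

/-- Classical solutions of `ε² u_xx = W'(u)` on the circle. -/
def IsAllenCahnSolution (ε : ℝ) (u : UnitAddCircle → ℝ) : Prop :=
  ContDiff ℝ 2 (fun s : ℝ => u (s : UnitAddCircle)) ∧
    ∀ x, ε ^ 2 * circleDeriv (circleDeriv u) x = deriv doubleWell (u x)

end CircleAllenCahn

end

/-! The balanced energy splits over arcs: it is the sum of `e(ℓ)` over the gaps `ℓ` between
consecutive nodes, where `e(ℓ)` is the least Dirichlet energy on an interval of length `ℓ`. The gaps
of the moving nodes are affine in `t` and all equal `1/(2p)` at `t = 0`, so the second variation is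
`e''(1/(2p))` times the sum of the squared differences of `f`. What remains is the strict concavity
of `e` for `ℓ > επ`; the hypothesis on `ε` says exactly that `1/(2p)` lies in this range.

Minimizers are explicit. Writing `u = √k sin θ`, the first integral `ε² u'² / 2 = W(u) - W(√k)`
becomes the regular equation `θ' = √(disc k θ) / (√2 ε)`, and the distance between zeros is `√2 ε
T(k)` with `T = periodIntegral`. Since `T` increases from `π/√2` at `k = 0` and is unbounded as `k →
1`, each `ℓ > επ` determines one `k` in `(0, 1)`.

Minimality and uniqueness come from a calibration (`IsHalfWave.integral_le_energy`). A positive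
solution `u` solves the linear equation `-φ'' = (1 - u²) φ / ε²`, hence `∫ h'² ≥ ∫ (1 - u²) h² / ε²`
for every `h` vanishing at the endpoints. Inserted in the energy, this leaves the energy of `u` plus
the defect `∫ (h² - u²)² / (4ε)`, so a minimizer is determined up to sign.

Concavity rests on `hasDerivAt_energyIntegral`: the normalized energy satisfies `E'(k) = (1 - k)²
T'(k)`. Hence `e'(ℓ) = (1 - k)² / (4ε)`, which decreases because `k` increases with `ℓ`. -/

noncomputable section

namespace CircleAllenCahn

/-! ### Explicit periodic solutions through a phase variable -/

/-- The discriminant `2 - k - k sin² θ` of the amplitude equation. -/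
def disc (k θ : ℝ) : ℝ := 2 - k - k * Real.sin θ ^ 2

/-- The time at which the profile of squared amplitude `k` has phase `θ`. -/
def phaseTime (ε k θ : ℝ) : ℝ := ∫ t in (0 : ℝ)..θ, √2 * ε / √(disc k t)

/-- The distance between consecutive zeros of the profile of squared amplitude `k`. -/
def halfPeriod (ε k : ℝ) : ℝ := phaseTime ε k Real.pi

/-- The phase of the profile of squared amplitude `k`. -/
def phase (ε k : ℝ) : ℝ → ℝ := Function.invFun (phaseTime ε k)

/-- The periodic solution of the Allen-Cahn equation of squared amplitude `k`. -/
def profile (ε k s : ℝ) : ℝ := √k * Real.sin (phase ε k s)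

section Profile

variable {ε k : ℝ}

lemma disc_ge (hk : 0 ≤ k) (θ : ℝ) : 2 * (1 - k) ≤ disc k θ := by
  have := Real.sin_sq_le_one θ
  unfold disc; nlinarith

lemma disc_le (hk : 0 ≤ k) (θ : ℝ) : disc k θ ≤ 2 := by
  have := sq_nonneg (Real.sin θ)
  unfold disc; nlinarith

lemma disc_pos (hk : 0 ≤ k) (hk1 : k < 1) (θ : ℝ) : 0 < disc k θ := by
  linarith [disc_ge hk θ]

lemma continuous_disc (k : ℝ) : Continuous (disc k) := by
  unfold disc; fun_prop

lemma hasDerivAt_disc (k θ : ℝ) :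
    HasDerivAt (disc k) (-(2 * k * Real.sin θ * Real.cos θ)) θ := by
  have := (((Real.hasDerivAt_sin θ).pow 2).const_mul k).const_sub (2 - k)
  refine this.congr_deriv ?_
  simp; ring

lemma continuous_speed_inv (hk : 0 ≤ k) (hk1 : k < 1) :
    Continuous fun t => √2 * ε / √(disc k t) :=
  continuous_const.div (continuous_disc k).sqrt fun t => (Real.sqrt_pos.2 (disc_pos hk hk1 t)).ne'

lemma hasDerivAt_phaseTime (hk : 0 ≤ k) (hk1 : k < 1) (θ : ℝ) :
    HasDerivAt (phaseTime ε k) (√2 * ε / √(disc k θ)) θ :=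
  intervalIntegral.integral_hasDerivAt_right
    ((continuous_speed_inv hk hk1).intervalIntegrable _ _)
    ((continuous_speed_inv hk hk1).stronglyMeasurableAtFilter _ _)
    (continuous_speed_inv hk hk1).continuousAt

lemma continuous_phaseTime (hk : 0 ≤ k) (hk1 : k < 1) : Continuous (phaseTime ε k) :=
  continuous_iff_continuousAt.2 fun θ => (hasDerivAt_phaseTime hk hk1 θ).continuousAt

lemma speed_inv_pos (hε : 0 < ε) (hk : 0 ≤ k) (hk1 : k < 1) (θ : ℝ) :
    0 < √2 * ε / √(disc k θ) := by
  have := Real.sqrt_pos.2 (disc_pos hk hk1 θ)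
  positivity

lemma strictMono_phaseTime (hε : 0 < ε) (hk : 0 ≤ k) (hk1 : k < 1) :
    StrictMono (phaseTime ε k) :=
  strictMono_of_hasDerivAt_pos (hasDerivAt_phaseTime hk hk1) (speed_inv_pos hε hk hk1)

lemma phaseTime_zero : phaseTime ε k 0 = 0 := by simp [phaseTime]

lemma disc_neg_arg (k t : ℝ) : disc k (-t) = disc k t := by simp [disc]

lemma disc_add_pi (k t : ℝ) : disc k (t + Real.pi) = disc k t := by simp [disc]

lemma phaseTime_neg (θ : ℝ) : phaseTime ε k (-θ) = -phaseTime ε k θ := by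
  have h := intervalIntegral.integral_comp_neg (fun t => √2 * ε / √(disc k t)) (a := 0) (b := θ)
  simp only [disc_neg_arg, neg_zero] at h
  rw [phaseTime, phaseTime, h, intervalIntegral.integral_symm]

lemma phaseTime_add_pi (hk : 0 ≤ k) (hk1 : k < 1) (θ : ℝ) :
    phaseTime ε k (θ + Real.pi) = phaseTime ε k θ + halfPeriod ε k := by
  have hi := fun a b => (continuous_speed_inv (ε := ε) hk hk1).intervalIntegrable (μ := volume) a b
  have h := intervalIntegral.integral_comp_add_right (fun t => √2 * ε / √(disc k t)) Real.pi
    (a := 0) (b := θ)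
  simp only [disc_add_pi, zero_add] at h
  rw [halfPeriod, phaseTime, phaseTime, phaseTime, h, add_comm (intervalIntegral _ _ _ _)]
  exact (intervalIntegral.integral_add_adjacent_intervals (hi _ _) (hi _ _)).symm

/-- The bound `disc ≤ 2` makes `phaseTime` grow at least linearly, hence surjective. -/
lemma le_speed_inv (hε : 0 < ε) (hk : 0 ≤ k) (hk1 : k < 1) (θ : ℝ) :
    ε ≤ √2 * ε / √(disc k θ) := by
  rw [le_div_iff₀ (Real.sqrt_pos.2 (disc_pos hk hk1 θ)), mul_comm]
  exact mul_le_mul_of_nonneg_right (Real.sqrt_le_sqrt (disc_le hk θ)) hε.le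

lemma mul_le_phaseTime (hε : 0 < ε) (hk : 0 ≤ k) (hk1 : k < 1) {θ : ℝ} (hθ : 0 ≤ θ) :
    ε * θ ≤ phaseTime ε k θ := by
  have := intervalIntegral.integral_mono_on hθ (f := fun _ => ε) (by simp)
    ((continuous_speed_inv hk hk1).intervalIntegrable (μ := volume) _ _)
    (fun x _ => le_speed_inv hε hk hk1 x)
  simpa [phaseTime, mul_comm] using this

lemma surjective_phaseTime (hε : 0 < ε) (hk : 0 ≤ k) (hk1 : k < 1) :
    Function.Surjective (phaseTime ε k) := by
  have h1 : Tendsto (phaseTime ε k) atTop atTop :=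
    tendsto_atTop_mono' atTop
      ((eventually_ge_atTop 0).mono fun θ hθ => mul_le_phaseTime hε hk hk1 hθ)
      (tendsto_id.const_mul_atTop hε)
  refine (continuous_phaseTime hk hk1).surjective h1 ?_
  have h2 : Tendsto (fun θ => -phaseTime ε k (-θ)) atBot atBot :=
    tendsto_neg_atTop_atBot.comp (h1.comp tendsto_neg_atBot_atTop)
  simpa [phaseTime_neg] using h2

lemma phase_phaseTime (hε : 0 < ε) (hk : 0 ≤ k) (hk1 : k < 1) (θ : ℝ) :
    phase ε k (phaseTime ε k θ) = θ :=
  Function.leftInverse_invFun (strictMono_phaseTime hε hk hk1).injective θ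

lemma phaseTime_phase (hε : 0 < ε) (hk : 0 ≤ k) (hk1 : k < 1) (s : ℝ) :
    phaseTime ε k (phase ε k s) = s :=
  Function.rightInverse_invFun (surjective_phaseTime hε hk hk1) s

lemma strictMono_phase (hε : 0 < ε) (hk : 0 ≤ k) (hk1 : k < 1) : StrictMono (phase ε k) := by
  intro a b hab
  rwa [← (strictMono_phaseTime hε hk hk1).lt_iff_lt, phaseTime_phase hε hk hk1,
    phaseTime_phase hε hk hk1]

lemma continuous_phase (hε : 0 < ε) (hk : 0 ≤ k) (hk1 : k < 1) : Continuous (phase ε k) :=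
  (strictMono_phase hε hk hk1).monotone.continuous_of_surjective fun θ =>
    ⟨_, phase_phaseTime hε hk hk1 θ⟩

/-- The turning-point factor `cos² θ` cancels from the first integral, so the phase has nonvanishing
speed even where the profile is stationary. -/
lemma hasDerivAt_phase (hε : 0 < ε) (hk : 0 ≤ k) (hk1 : k < 1) (s : ℝ) :
    HasDerivAt (phase ε k) (√(disc k (phase ε k s)) / (√2 * ε)) s := by
  have := HasDerivAt.of_local_left_inverse (continuous_phase hε hk hk1).continuousAt
    (hasDerivAt_phaseTime (ε := ε) hk hk1 (phase ε k s)) (speed_inv_pos hε hk hk1 _).ne'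
    (Eventually.of_forall (phaseTime_phase hε hk hk1))
  rwa [inv_div] at this

lemma phase_zero (hε : 0 < ε) (hk : 0 ≤ k) (hk1 : k < 1) : phase ε k 0 = 0 := by
  simpa [phaseTime_zero] using phase_phaseTime hε hk hk1 0

lemma phase_halfPeriod (hε : 0 < ε) (hk : 0 ≤ k) (hk1 : k < 1) :
    phase ε k (halfPeriod ε k) = Real.pi :=
  phase_phaseTime hε hk hk1 _

lemma phase_neg (hε : 0 < ε) (hk : 0 ≤ k) (hk1 : k < 1) (s : ℝ) :
    phase ε k (-s) = -phase ε k s := by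
  rw [← phase_phaseTime hε hk hk1 (-phase ε k s), phaseTime_neg, phaseTime_phase hε hk hk1]

lemma phase_add_halfPeriod (hε : 0 < ε) (hk : 0 ≤ k) (hk1 : k < 1) (s : ℝ) :
    phase ε k (s + halfPeriod ε k) = phase ε k s + Real.pi := by
  rw [← phase_phaseTime hε hk hk1 (phase ε k s + Real.pi), phaseTime_add_pi hk hk1,
    phaseTime_phase hε hk hk1]

lemma hasDerivAt_profile (hε : 0 < ε) (hk : 0 ≤ k) (hk1 : k < 1) (s : ℝ) :
    HasDerivAt (profile ε k)
      (√k * (Real.cos (phase ε k s) * (√(disc k (phase ε k s)) / (√2 * ε)))) s :=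
  ((hasDerivAt_phase hε hk hk1 s).sin).const_mul _

lemma deriv_profile (hε : 0 < ε) (hk : 0 ≤ k) (hk1 : k < 1) :
    deriv (profile ε k) = fun s =>
      √k * (Real.cos (phase ε k s) * (√(disc k (phase ε k s)) / (√2 * ε))) :=
  funext fun s => (hasDerivAt_profile hε hk hk1 s).deriv

lemma hasDerivAt_deriv_profile (hε : 0 < ε) (hk : 0 ≤ k) (hk1 : k < 1) (s : ℝ) :
    HasDerivAt (deriv (profile ε k)) ((profile ε k s ^ 3 - profile ε k s) / ε ^ 2) s := by
  rw [deriv_profile hε hk hk1]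
  have hp := hasDerivAt_phase hε hk hk1 s
  have hd := disc_pos hk hk1 (phase ε k s)
  have h1 : HasDerivAt (fun s => √(disc k (phase ε k s))) _ s :=
    ((hasDerivAt_disc k (phase ε k s)).comp s hp).sqrt hd.ne'
  refine ((hp.cos.mul (h1.div_const (√2 * ε))).const_mul √k).congr_deriv ?_
  have hq : √(disc k (phase ε k s)) ≠ 0 := (Real.sqrt_pos.2 hd).ne'
  have e1 := Real.sq_sqrt hd.le
  have e2 : √2 ^ 2 = (2 : ℝ) := Real.sq_sqrt (by norm_num)
  have e3 : √k ^ 2 = k := Real.sq_sqrt hk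
  have e4 := Real.sin_sq_add_cos_sq (phase ε k s)
  have h2 : (√2 : ℝ) ≠ 0 := by positivity
  unfold profile
  simp only [Function.comp]
  set q := √(disc k (phase ε k s))
  unfold disc at e1
  set x := Real.sin (phase ε k s)
  set y := Real.cos (phase ε k s)
  have e5 : y ^ 2 = 1 - x ^ 2 := by linarith
  field_simp
  rw [e1, e2, e3, e5]
  ring

lemma deriv_profile_sq (hε : 0 < ε) (hk : 0 ≤ k) (hk1 : k < 1) (s : ℝ) :
    deriv (profile ε k) s ^ 2 =
      k * Real.cos (phase ε k s) ^ 2 * disc k (phase ε k s) / (2 * ε ^ 2) := by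
  rw [deriv_profile hε hk hk1]
  simp only [mul_pow, div_pow]
  rw [Real.sq_sqrt hk, Real.sq_sqrt (disc_pos hk hk1 _).le, Real.sq_sqrt (by norm_num)]
  ring

end Profile

/-! ### Half waves and their minimality -/

/-- A solution of `ε² u'' = u³ - u` which is odd, changes sign under translation by `L` and is
positive on `(0, L)`. -/
structure IsHalfWave (ε L : ℝ) (u : ℝ → ℝ) : Prop where
  hasDerivAt : ∀ s, HasDerivAt u (deriv u s) s
  hasDerivAt_deriv : ∀ s, HasDerivAt (deriv u) ((u s ^ 3 - u s) / ε ^ 2) s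
  odd : ∀ s, u (-s) = -u s
  add_period : ∀ s, u (s + L) = -u s
  pos : ∀ s ∈ Ioo 0 L, 0 < u s
  deriv_zero_pos : 0 < deriv u 0
  lipschitz : ∃ K, LipschitzWith K u

lemma isHalfWave_profile {ε k : ℝ} (hε : 0 < ε) (hk : 0 < k) (hk1 : k < 1) :
    IsHalfWave ε (halfPeriod ε k) (profile ε k) where
  hasDerivAt s := (hasDerivAt_profile hε hk.le hk1 s).differentiableAt.hasDerivAt
  hasDerivAt_deriv := hasDerivAt_deriv_profile hε hk.le hk1
  odd s := by simp [profile, phase_neg hε hk.le hk1]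
  add_period s := by simp [profile, phase_add_halfPeriod hε hk.le hk1]
  pos s hs := by
    have hm := strictMono_phase hε hk.le hk1
    refine mul_pos (Real.sqrt_pos.2 hk) (Real.sin_pos_of_pos_of_lt_pi ?_ ?_)
    · simpa [phase_zero hε hk.le hk1] using hm hs.1
    · simpa [phase_halfPeriod hε hk.le hk1] using hm hs.2
  deriv_zero_pos := by
    rw [deriv_profile hε hk.le hk1]
    have := Real.sqrt_pos.2 (disc_pos hk.le hk1 0)
    simp only [phase_zero hε hk.le hk1, Real.cos_zero]
    positivity
  lipschitz := by
    -- The first integral bounds `u'²` by `1 · 1 · 2 / (2 ε²) = 1 / ε²`.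
    refine ⟨Real.toNNReal (1 / ε), lipschitzWith_of_nnnorm_deriv_le
      (fun s => (hasDerivAt_profile hε hk.le hk1 s).differentiableAt) fun s => ?_⟩
    rw [← NNReal.coe_le_coe, coe_nnnorm, Real.norm_eq_abs, Real.coe_toNNReal _ (by positivity)]
    refine abs_le_of_sq_le_sq ?_ (by positivity)
    rw [deriv_profile_sq hε hk.le hk1]
    have h1 := disc_le hk.le (phase ε k s)
    have h2 := disc_pos hk.le hk1 (phase ε k s)
    have h3 := Real.cos_sq_le_one (phase ε k s)
    have h4 := sq_nonneg (Real.cos (phase ε k s))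
    rw [div_pow, div_le_div_iff₀ (by positivity) (by positivity)]
    have : k * Real.cos (phase ε k s) ^ 2 * disc k (phase ε k s) ≤ 1 * 1 * 2 := by gcongr
    nlinarith [sq_nonneg ε]

namespace IsHalfWave

variable {ε L : ℝ} {u : ℝ → ℝ}

lemma continuous (hu : IsHalfWave ε L u) : Continuous u :=
  continuous_iff_continuousAt.2 fun s => (hu.hasDerivAt s).continuousAt

lemma continuous_deriv (hu : IsHalfWave ε L u) : Continuous (deriv u) :=
  continuous_iff_continuousAt.2 fun s => (hu.hasDerivAt_deriv s).continuousAt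

lemma deriv_deriv (hu : IsHalfWave ε L u) (s : ℝ) :
    deriv (deriv u) s = (u s ^ 3 - u s) / ε ^ 2 :=
  (hu.hasDerivAt_deriv s).deriv

lemma contDiff (hu : IsHalfWave ε L u) : ContDiff ℝ 2 u := by
  have h0 : ContDiff ℝ 0 (deriv (deriv u)) := by
    rw [contDiff_zero, funext hu.deriv_deriv]
    exact ((hu.continuous.pow 3).sub hu.continuous).div_const _
  have h1 : ContDiff ℝ (0 + 1) (deriv u) := contDiff_succ_iff_deriv.2
    ⟨fun s => (hu.hasDerivAt_deriv s).differentiableAt, by simp, h0⟩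
  rw [zero_add] at h1
  have h2 : ContDiff ℝ (1 + 1) u := contDiff_succ_iff_deriv.2
    ⟨fun s => (hu.hasDerivAt s).differentiableAt, by simp, h1⟩
  rwa [one_add_one_eq_two] at h2

lemma apply_zero (hu : IsHalfWave ε L u) : u 0 = 0 := by
  have := hu.odd 0
  rw [neg_zero] at this
  linarith

lemma apply_period (hu : IsHalfWave ε L u) : u L = 0 := by
  have := hu.add_period 0
  rwa [hu.apply_zero, zero_add, neg_zero] at this

lemma apply_period_sub (hu : IsHalfWave ε L u) (s : ℝ) : u (L - s) = u s := by
  rw [sub_eq_neg_add, hu.add_period, hu.odd, neg_neg]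

lemma nonneg (hu : IsHalfWave ε L u) {s : ℝ} (hs : s ∈ Icc 0 L) : 0 ≤ u s := by
  rcases hs.1.eq_or_lt with rfl | h0
  · exact hu.apply_zero.ge
  rcases hs.2.eq_or_lt with rfl | h1
  · exact hu.apply_period.ge
  exact (hu.pos s ⟨h0, h1⟩).le

lemma add_nat_mul (hu : IsHalfWave ε L u) (s : ℝ) (n : ℕ) :
    u (s + n * L) = (-1) ^ n * u s := by
  induction n with
  | zero => simp
  | succ n ih =>
    rw [show s + ((n + 1 : ℕ) : ℝ) * L = s + n * L + L by push_cast; ring, hu.add_period, ih,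
      pow_succ]
    ring

/-- The energy of a half wave on the interval between two zeros. -/
lemma integral_energy (hu : IsHalfWave ε L u) (hε : ε ≠ 0) :
    ∫ s in (0 : ℝ)..L, (ε / 2 * deriv u s ^ 2 + 1 / ε * doubleWell (u s)) =
      ∫ s in (0 : ℝ)..L, (1 - u s ^ 4) / (4 * ε) := by
  have hc := hu.continuous
  have hc' := hu.continuous_deriv
  -- The equation tested with `u` itself; the boundary terms vanish because `u` does.
  have hd : ∀ s, HasDerivAt (fun s => ε / 2 * (u s * deriv u s))
      (ε / 2 * deriv u s ^ 2 + 1 / ε * doubleWell (u s) - (1 - u s ^ 4) / (4 * ε)) s := by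
    intro s
    refine (((hu.hasDerivAt s).mul (hu.hasDerivAt_deriv s)).const_mul (ε / 2)).congr_deriv ?_
    unfold doubleWell
    field_simp
    ring
  have h2 : Continuous fun s => (1 - u s ^ 4) / (4 * ε) := by fun_prop
  have h1 : Continuous fun s => ε / 2 * deriv u s ^ 2 + 1 / ε * doubleWell (u s) := by
    unfold doubleWell; fun_prop
  have := intervalIntegral.integral_eq_sub_of_hasDerivAt (fun s _ => hd s)
    ((h1.sub h2).intervalIntegrable 0 L)
  rw [intervalIntegral.integral_sub (h1.intervalIntegrable _ _) (h2.intervalIntegrable _ _),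
    hu.apply_zero, hu.apply_period] at this
  linarith

/-- The Picone-type inequality obtained from the positive supersolution `u + δ`. -/
lemma picone_le (hu : IsHalfWave ε L u) (hL : 0 < L) {h : ℝ → ℝ}
    (hac : AbsolutelyContinuousOnInterval h 0 L) (h0 : h 0 = 0) (h1 : h L = 0)
    (hint : IntervalIntegrable (fun s => deriv h s ^ 2) volume 0 L) {δ : ℝ} (hδ : 0 < δ) :
    ∫ s in (0 : ℝ)..L, (u s - u s ^ 3) / ε ^ 2 / (u s + δ) * h s ^ 2 ≤
      ∫ s in (0 : ℝ)..L, deriv h s ^ 2 := by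
  have hpos : ∀ s ∈ Icc 0 L, 0 < u s + δ := fun s hs => by linarith [hu.nonneg hs]
  -- The logarithmic derivative of `u + δ`. The shift keeps it bounded up to the endpoints, where `u
  -- = 0`.
  set ρ : ℝ → ℝ := fun s => deriv u s / (u s + δ) with hρ
  have hρd : ∀ s ∈ Icc 0 L, HasDerivAt ρ
      (((u s ^ 3 - u s) / ε ^ 2 * (u s + δ) - deriv u s * deriv u s) / (u s + δ) ^ 2) s :=
    fun s hs => (hu.hasDerivAt_deriv s).div ((hu.hasDerivAt s).add_const δ) (hpos s hs).ne'
  have hρac : AbsolutelyContinuousOnInterval ρ 0 L := by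
    apply ContDiffOn.absolutelyContinuousOnInterval
    rw [uIcc_of_le hL.le]
    have hcd : ContDiff ℝ (1 + 1) u := by rw [one_add_one_eq_two]; exact hu.contDiff
    exact ((contDiff_succ_iff_deriv.1 hcd).2.2.contDiffOn).div
      ((hu.contDiff.of_le (by norm_num)).add contDiff_const).contDiffOn fun s hs => (hpos s hs).ne'
  have hparts := hρac.integral_deriv_mul_eq_sub (hac.fun_mul hac)
  simp only [h0, h1, mul_zero, sub_zero] at hparts
  have hi1 : IntervalIntegrable
      (fun s => deriv ρ s * (h s * h s) + ρ s * deriv (fun x => h x * h x) s) volume 0 L := by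
    refine (hρac.fun_mul (hac.fun_mul hac)).intervalIntegrable_deriv.congr_ae ?_
    rw [uIoc_of_le hL.le]
    refine (ae_restrict_iff' measurableSet_Ioc).2 ?_
    filter_upwards [(hac.fun_mul hac).ae_differentiableAt] with s hs hs'
    have hs1 : s ∈ Icc 0 L := Ioc_subset_Icc_self hs'
    exact (((hρd s hs1).differentiableAt.hasDerivAt).mul
      (hs (by rwa [uIcc_of_le hL.le])).hasDerivAt).deriv
  have hcont : ContinuousOn (fun s => (u s - u s ^ 3) / ε ^ 2 / (u s + δ) * h s ^ 2)
      (uIcc 0 L) := by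
    have hc := hu.continuous
    refine ContinuousOn.mul (ContinuousOn.div (by fun_prop) (by fun_prop) ?_)
      (hac.continuousOn.pow 2)
    rw [uIcc_of_le hL.le]
    exact fun s hs => (hpos s hs).ne'
  have hi2 := hcont.intervalIntegrable (μ := volume)
  have hadd := intervalIntegral.integral_add hi1 hi2
  rw [hparts, zero_add] at hadd
  rw [← hadd]
  refine intervalIntegral.integral_mono_ae_restrict hL.le (hi1.add hi2) hint ?_
  refine (ae_restrict_iff' measurableSet_Icc).2 ?_
  filter_upwards [hac.ae_differentiableAt] with s hs hs1
  have hd := (hs (by rwa [uIcc_of_le hL.le])).hasDerivAt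
  have hd2 : deriv (fun x => h x * h x) s = deriv h s * h s + h s * deriv h s :=
    (hd.mul hd).deriv
  have hz := hpos s hs1
  rw [(hρd s hs1).deriv, hd2]
  -- Picone's identity: subtracting `(ρ h²)'`, whose integral is zero, and the potential term from
  -- `h'²` leaves a perfect square.
  have : deriv h s ^ 2 - ((((u s ^ 3 - u s) / ε ^ 2 * (u s + δ) - deriv u s * deriv u s) /
      (u s + δ) ^ 2) * (h s * h s) + ρ s * (deriv h s * h s + h s * deriv h s) +
      (u s - u s ^ 3) / ε ^ 2 / (u s + δ) * h s ^ 2) = (deriv h s - ρ s * h s) ^ 2 := by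
    simp only [hρ]
    rw [show u s - u s ^ 3 = -(u s ^ 3 - u s) by ring]
    rw [show -(u s ^ 3 - u s) / ε ^ 2 = -((u s ^ 3 - u s) / ε ^ 2) by ring]
    generalize (u s ^ 3 - u s) / ε ^ 2 = A
    field_simp
    ring
  nlinarith [sq_nonneg (deriv h s - ρ s * h s)]

/-- Limit `δ → 0` of `picone_le`. The factor `u / (u + δ)` lies in `[0, 1]` and tends to `1` where
`u > 0`, so dominated convergence applies. -/
lemma integral_mul_sq_le (hu : IsHalfWave ε L u) (hL : 0 < L) {h : ℝ → ℝ}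
    (hac : AbsolutelyContinuousOnInterval h 0 L) (h0 : h 0 = 0) (h1 : h L = 0)
    (hint : IntervalIntegrable (fun s => deriv h s ^ 2) volume 0 L) :
    ∫ s in (0 : ℝ)..L, (1 - u s ^ 2) / ε ^ 2 * h s ^ 2 ≤ ∫ s in (0 : ℝ)..L, deriv h s ^ 2 := by
  have hc := hu.continuous
  have hlim : Tendsto (fun δ : ℝ => ∫ s in (0 : ℝ)..L,
      (u s - u s ^ 3) / ε ^ 2 / (u s + δ) * h s ^ 2) (𝓝[>] 0)
      (𝓝 (∫ s in (0 : ℝ)..L, (1 - u s ^ 2) / ε ^ 2 * h s ^ 2)) := by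
    refine intervalIntegral.tendsto_integral_filter_of_dominated_convergence
      (fun s => |(1 - u s ^ 2) / ε ^ 2 * h s ^ 2|) ?_ ?_ ?_ ?_
    · filter_upwards [self_mem_nhdsWithin] with δ hδ
      rw [uIoc_of_le hL.le]
      refine ContinuousOn.aestronglyMeasurable ?_ measurableSet_Ioc
      refine ContinuousOn.mul (ContinuousOn.div (by fun_prop) (by fun_prop) ?_)
        ((hac.continuousOn.mono ?_).pow 2)
      · intro s hs
        have := hu.nonneg (Ioc_subset_Icc_self hs)
        exact (add_pos_of_nonneg_of_pos this hδ).ne'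
      · rw [uIcc_of_le hL.le]; exact Ioc_subset_Icc_self
    · filter_upwards [self_mem_nhdsWithin] with δ hδ
      refine Eventually.of_forall fun s hs => ?_
      rw [uIoc_of_le hL.le] at hs
      have h2 := hu.nonneg (Ioc_subset_Icc_self hs)
      have hδ' : 0 < δ := hδ
      have : (u s - u s ^ 3) / ε ^ 2 / (u s + δ) * h s ^ 2 =
          (u s / (u s + δ)) * ((1 - u s ^ 2) / ε ^ 2 * h s ^ 2) := by ring
      rw [Real.norm_eq_abs, this, abs_mul, abs_of_nonneg (by positivity)]
      exact mul_le_of_le_one_left (abs_nonneg _) ((div_le_one (by positivity)).2 (by linarith))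
    · have : ContinuousOn (fun s => (1 - u s ^ 2) / ε ^ 2 * h s ^ 2) (uIcc 0 L) :=
        ContinuousOn.mul (by fun_prop) (hac.continuousOn.pow 2)
      exact this.abs.intervalIntegrable
    · refine Eventually.of_forall fun s hs => ?_
      rw [uIoc_of_le hL.le] at hs
      rcases hs.2.eq_or_lt with rfl | hs2
      · simp [h1]
      have hp := hu.pos s ⟨hs.1, hs2⟩
      have : Tendsto (fun δ : ℝ => (u s - u s ^ 3) / ε ^ 2 / (u s + δ) * h s ^ 2) (𝓝 0)
          (𝓝 ((u s - u s ^ 3) / ε ^ 2 / (u s + 0) * h s ^ 2)) := by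
        refine ((tendsto_const_nhds.div (tendsto_const_nhds.add tendsto_id) ?_)).mul_const _
        simpa using hp.ne'
      refine (this.mono_left nhdsWithin_le_nhds).congr' (Eventually.of_forall fun _ => rfl) |>.trans
        (le_of_eq ?_)
      congr 1
      rw [add_zero]
      field_simp
  exact le_of_tendsto hlim (by
    filter_upwards [self_mem_nhdsWithin] with δ hδ
    exact hu.picone_le hL hac h0 h1 hint hδ)

/-- Calibration: among the functions vanishing at `0` and `L` the half wave minimizes the energy,
with a defect that controls the distance of the squares. -/
lemma integral_le_energy (hu : IsHalfWave ε L u) (hε : 0 < ε) (hL : 0 < L) {h : ℝ → ℝ}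
    (hac : AbsolutelyContinuousOnInterval h 0 L) (h0 : h 0 = 0) (h1 : h L = 0)
    (hint : IntervalIntegrable (fun s => deriv h s ^ 2) volume 0 L) :
    (∫ s in (0 : ℝ)..L, (1 - u s ^ 4) / (4 * ε)) +
        ∫ s in (0 : ℝ)..L, (h s ^ 2 - u s ^ 2) ^ 2 / (4 * ε) ≤
      ∫ s in (0 : ℝ)..L, (ε / 2 * deriv h s ^ 2 + 1 / ε * doubleWell (h s)) := by
  have hc := hu.continuous
  have hh := hac.continuousOn
  have i1 : IntervalIntegrable (fun s => (1 - u s ^ 4) / (4 * ε)) volume 0 L :=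
    ContinuousOn.intervalIntegrable (by fun_prop)
  have i2 : IntervalIntegrable (fun s => (h s ^ 2 - u s ^ 2) ^ 2 / (4 * ε)) volume 0 L :=
    ContinuousOn.intervalIntegrable (by fun_prop)
  have i3 : IntervalIntegrable (fun s => 1 / ε * doubleWell (h s)) volume 0 L :=
    ContinuousOn.intervalIntegrable (by unfold doubleWell; fun_prop)
  have i4 : IntervalIntegrable (fun s => (1 - u s ^ 2) / ε ^ 2 * h s ^ 2) volume 0 L :=
    ContinuousOn.intervalIntegrable (by fun_prop)
  rw [intervalIntegral.integral_add (hint.const_mul _) i3, intervalIntegral.integral_const_mul,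
    ← intervalIntegral.integral_add i1 i2]
  have hk := mul_le_mul_of_nonneg_left (hu.integral_mul_sq_le hL hac h0 h1 hint)
    (show 0 ≤ ε / 2 by positivity)
  refine le_trans (le_of_eq ?_) (add_le_add_left hk _)
  rw [← intervalIntegral.integral_const_mul, ← intervalIntegral.integral_add (i4.const_mul _) i3]
  -- Completing the square: `2(1 - u²)h² + (1 - h²)² = (1 - u⁴) + (h² - u²)²`.
  refine intervalIntegral.integral_congr fun s _ => ?_
  simp only [doubleWell]
  field_simp
  ring

end IsHalfWave

/-! ### Sobolev functions on the circle -/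

lemma circleDeriv_coe (w : UnitAddCircle → ℝ) (s : ℝ) :
    circleDeriv w (s : UnitAddCircle) = deriv (fun r : ℝ => w (r : UnitAddCircle)) s := by
  have := deriv_comp_const_add (f := fun r : ℝ => w (r : UnitAddCircle)) s 0
  rw [add_zero] at this
  rw [← this, circleDeriv]
  simp only [AddCircle.coe_add]

lemma circleDeriv_neg (w : UnitAddCircle → ℝ) (x : UnitAddCircle) :
    circleDeriv (-w) x = -circleDeriv w x := by
  simp only [circleDeriv, Pi.neg_apply]
  exact deriv.fun_neg

lemma measurable_circleDeriv {w : UnitAddCircle → ℝ} (hw : Continuous w) :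
    Measurable (circleDeriv w) := by
  have hc : Continuous (Function.uncurry fun (x : UnitAddCircle) (s : ℝ) =>
      w (x + (s : UnitAddCircle))) :=
    hw.comp (continuous_fst.add ((AddCircle.continuous_mk' 1).comp continuous_snd))
  exact (measurable_deriv_with_param hc).comp (measurable_id.prodMk measurable_const)

lemma intervalIntegrable_coe {F : UnitAddCircle → ℝ} (hF : Integrable F volume) (a b : ℝ) :
    IntervalIntegrable (fun s : ℝ => F (s : UnitAddCircle)) volume a b := by
  have hp : Function.Periodic (fun s : ℝ => F (s : UnitAddCircle)) 1 := fun s => by simp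
  refine hp.intervalIntegrable₀ one_ne_zero ?_ a b
  rw [intervalIntegrable_iff_integrableOn_Ioc_of_le zero_le_one]
  have := (UnitAddCircle.measurePreserving_mk 0).integrable_comp_of_integrable hF
  rw [zero_add] at this
  exact this

lemma lipschitzWith_coe : LipschitzWith 1 ((↑) : ℝ → UnitAddCircle) := by
  refine LipschitzWith.of_dist_le_mul fun x y => ?_
  rw [dist_eq_norm, ← AddCircle.coe_sub, NNReal.coe_one, one_mul, Real.dist_eq,
    UnitAddCircle.norm_eq]
  exact (round_le (x - y) 0).trans (by simp)

lemma continuous_of_continuous_coe {w : UnitAddCircle → ℝ}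
    (hw : Continuous fun s : ℝ => w (s : UnitAddCircle)) : Continuous w :=
  (QuotientAddGroup.isQuotientMap_mk (AddSubgroup.zmultiples (1 : ℝ))).continuous_iff.2 hw

/-- Lipschitz functions on the circle are Sobolev functions. -/
lemma isW12_of_lipschitzWith {K : NNReal} {w : UnitAddCircle → ℝ} (hw : LipschitzWith K w) :
    IsW12 w := by
  have hl : LipschitzWith K fun s : ℝ => w (s : UnitAddCircle) := by
    have := hw.comp lipschitzWith_coe
    rwa [mul_one] at this
  constructor
  · refine MemLp.of_bound (measurable_circleDeriv hw.continuous).aestronglyMeasurable K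
      (Eventually.of_forall fun x => ?_)
    obtain ⟨s, rfl⟩ := QuotientAddGroup.mk_surjective x
    exact (circleDeriv_coe w s).symm ▸ norm_deriv_le_of_lipschitz hl
  · intro a b
    simp_rw [circleDeriv_coe]
    exact ((hl.lipschitzOnWith (s := uIcc a b)).absolutelyContinuousOnInterval
      |>.integral_deriv_eq_sub).symm

namespace IsW12

variable {w : UnitAddCircle → ℝ}

lemma neg (hw : IsW12 w) : IsW12 (-w) := by
  have : circleDeriv (-w) = -circleDeriv w := funext fun x => circleDeriv_neg w x
  refine ⟨by rw [this]; exact hw.1.neg, fun a b => ?_⟩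
  simp only [this, Pi.neg_apply, intervalIntegral.integral_neg, ← hw.2 a b]
  ring

lemma absolutelyContinuousOnInterval (hw : IsW12 w) (a b : ℝ) :
    AbsolutelyContinuousOnInterval (fun s : ℝ => w (s : UnitAddCircle)) a b := by
  have hi := intervalIntegrable_coe (hw.1.integrable (by norm_num)) a b
  have h1 := hi.absolutelyContinuousOnInterval_intervalIntegral (c := a) left_mem_uIcc
  have h2 : AbsolutelyContinuousOnInterval (fun _ : ℝ => w (a : UnitAddCircle)) a b :=
    contDiffOn_const.absolutelyContinuousOnInterval
  have heq : (fun s : ℝ => w (s : UnitAddCircle)) = fun s =>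
      (∫ r in a..s, circleDeriv w (r : UnitAddCircle)) + w (a : UnitAddCircle) :=
    funext fun s => by rw [← hw.2 a s]; ring
  rw [heq]
  exact h1.fun_add h2

lemma continuous_coe (hw : IsW12 w) : Continuous fun s : ℝ => w (s : UnitAddCircle) := by
  refine continuous_iff_continuousAt.2 fun s => ?_
  have := (hw.absolutelyContinuousOnInterval (s - 1) (s + 1)).continuousOn
  rw [uIcc_of_le (by linarith)] at this
  exact this.continuousAt (Icc_mem_nhds (by linarith) (by linarith))

lemma continuous (hw : IsW12 w) : Continuous w :=
  continuous_of_continuous_coe hw.continuous_coe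

lemma integrable_energy (hw : IsW12 w) (ε : ℝ) :
    Integrable (fun x => ε / 2 * circleDeriv w x ^ 2 + 1 / ε * doubleWell (w x)) volume := by
  refine (hw.1.integrable_sq.const_mul _).add ?_
  have hc : Continuous fun x => 1 / ε * doubleWell (w x) := by
    have := hw.continuous
    unfold doubleWell; fun_prop
  exact hc.integrable_of_hasCompactSupport (HasCompactSupport.of_compactSpace _)

lemma integral_le_energy (hw : IsW12 w) {ε a b : ℝ} {u : ℝ → ℝ} (hu : IsHalfWave ε (b - a) u)
    (hε : 0 < ε) (hab : a < b) (ha : w (a : UnitAddCircle) = 0) (hb : w (b : UnitAddCircle) = 0) :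
    (∫ s in (0 : ℝ)..(b - a), (1 - u s ^ 4) / (4 * ε)) +
        ∫ s in (0 : ℝ)..(b - a),
          (w ((a + s : ℝ) : UnitAddCircle) ^ 2 - u s ^ 2) ^ 2 / (4 * ε) ≤
      ∫ s in a..b, (ε / 2 * circleDeriv w (s : UnitAddCircle) ^ 2
        + 1 / ε * doubleWell (w (s : UnitAddCircle))) := by
  have hd : ∀ s, deriv (fun r : ℝ => w ((a + r : ℝ) : UnitAddCircle)) s =
      circleDeriv w ((a + s : ℝ) : UnitAddCircle) := fun s => by
    rw [circleDeriv_coe]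
    exact deriv_comp_const_add (f := fun r : ℝ => w (r : UnitAddCircle)) a s
  have hi : IntervalIntegrable
      (fun s => circleDeriv w ((a + s : ℝ) : UnitAddCircle)) volume 0 (b - a) := by
    have := (intervalIntegrable_coe (hw.1.integrable (by norm_num)) a b).comp_add_left a
    rwa [sub_self] at this
  have hac : AbsolutelyContinuousOnInterval
      (fun s : ℝ => w ((a + s : ℝ) : UnitAddCircle)) 0 (b - a) := by
    have h1 := hi.absolutelyContinuousOnInterval_intervalIntegral (c := 0) left_mem_uIcc
    have h2 : AbsolutelyContinuousOnInterval (fun _ : ℝ => w (a : UnitAddCircle)) 0 (b - a) :=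
      contDiffOn_const.absolutelyContinuousOnInterval
    have heq : (fun s : ℝ => w ((a + s : ℝ) : UnitAddCircle)) = fun s =>
        (∫ r in (0 : ℝ)..s, circleDeriv w ((a + r : ℝ) : UnitAddCircle)) + w (a : UnitAddCircle) :=
      funext fun s => by
        rw [intervalIntegral.integral_comp_add_left
          (fun s : ℝ => circleDeriv w (s : UnitAddCircle)) a, add_zero, ← hw.2]
        ring
    rw [heq]
    exact h1.fun_add h2
  have hint : IntervalIntegrable
      (fun s => deriv (fun r : ℝ => w ((a + r : ℝ) : UnitAddCircle)) s ^ 2) volume 0 (b - a) := by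
    simp_rw [hd]
    have := (intervalIntegrable_coe hw.1.integrable_sq a b).comp_add_left a
    rwa [sub_self] at this
  have := hu.integral_le_energy hε (sub_pos.2 hab) hac (by simpa using ha) (by simpa using hb) hint
  simp_rw [hd] at this
  rwa [intervalIntegral.integral_comp_add_left (fun s : ℝ =>
    ε / 2 * circleDeriv w (s : UnitAddCircle) ^ 2 + 1 / ε * doubleWell (w (s : UnitAddCircle))) a,
    add_zero, add_sub_cancel] at this

end IsW12

/-- The energy on an arc of a function that is there a translate of a half wave up to sign. -/
lemma integral_energy_of_eqOn {ε a b σ : ℝ} {u : ℝ → ℝ} {U : UnitAddCircle → ℝ}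
    (hu : IsHalfWave ε (b - a) u) (hε : ε ≠ 0) (hab : a ≤ b) (hσ : σ ^ 2 = 1)
    (hU : ∀ s ∈ Ioo a b, U (s : UnitAddCircle) = σ * u (s - a)) :
    ∫ s in a..b, (ε / 2 * circleDeriv U (s : UnitAddCircle) ^ 2
        + 1 / ε * doubleWell (U (s : UnitAddCircle))) =
      ∫ s in (0 : ℝ)..(b - a), (1 - u s ^ 4) / (4 * ε) := by
  rw [← hu.integral_energy hε]
  have := intervalIntegral.integral_comp_sub_right
    (fun s => ε / 2 * deriv u s ^ 2 + 1 / ε * doubleWell (u s)) a (a := a) (b := b)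
  rw [sub_self] at this
  rw [← this, intervalIntegral.integral_of_le hab, intervalIntegral.integral_of_le hab,
    integral_Ioc_eq_integral_Ioo, integral_Ioc_eq_integral_Ioo]
  refine setIntegral_congr_fun measurableSet_Ioo fun s hs => ?_
  have hd : circleDeriv U (s : UnitAddCircle) = σ * deriv u (s - a) := by
    rw [circleDeriv_coe]
    have h1 : (fun r : ℝ => U (r : UnitAddCircle)) =ᶠ[𝓝 s] fun r => σ * u (r - a) := by
      filter_upwards [Ioo_mem_nhds hs.1 hs.2] with r hr using hU r hr
    rw [h1.deriv_eq]
    exact (((hu.hasDerivAt (s - a)).comp_sub_const s a).const_mul σ).deriv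
  simp only [hd, hU s hs, mul_pow, hσ, one_mul, doubleWell]

/-! ### Arcs and bumps -/

lemma isOpen_arc (a b : ℝ) : IsOpen (arc a b) :=
  QuotientAddGroup.isOpenMap_coe _ isOpen_Ioo

lemma exists_int_add_of_coe_eq {r s : ℝ} (h : (r : UnitAddCircle) = (s : UnitAddCircle)) :
    ∃ n : ℤ, r = s + n := by
  obtain ⟨n, hn⟩ := (AddCircle.coe_eq_zero_iff 1).1
    (show ((r - s : ℝ) : UnitAddCircle) = 0 by rw [AddCircle.coe_sub, h, sub_self])
  exact ⟨n, by rw [zsmul_one] at hn; linarith⟩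

lemma coe_eq_of_abs_sub_lt {r s : ℝ} (h : (r : UnitAddCircle) = (s : UnitAddCircle))
    (hlt : |r - s| < 1) : r = s := by
  obtain ⟨n, rfl⟩ := exists_int_add_of_coe_eq h
  rw [add_sub_cancel_left] at hlt
  have : |n| < 1 := by exact_mod_cast hlt
  rw [Int.abs_lt_one_iff.1 this]
  simp

lemma coe_mem_arc_iff {a b s : ℝ} (hb : b ≤ a + 1) (hs : s ∈ Icc a (a + 1)) :
    (s : UnitAddCircle) ∈ arc a b ↔ s ∈ Ioo a b := by
  refine ⟨?_, fun h => ⟨s, h, rfl⟩⟩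
  rintro ⟨r, hr, hrs⟩
  rwa [← coe_eq_of_abs_sub_lt hrs (by rw [abs_lt]; constructor <;> linarith [hr.1, hr.2, hs.1, hs.2])]

lemma setIntegral_arc {a b : ℝ} (hab : a ≤ b) (hb : b ≤ a + 1) (F : UnitAddCircle → ℝ) :
    ∫ x in arc a b, F x = ∫ s in a..b, F (s : UnitAddCircle) := by
  rw [← integral_indicator (isOpen_arc a b).measurableSet, ← UnitAddCircle.integral_preimage a,
    intervalIntegral.integral_of_le hab, integral_Ioc_eq_integral_Ioo (y := b),
    ← inter_eq_right.2 (show Ioo a b ⊆ Ioc a (a + 1) from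
      fun s hs => ⟨hs.1, (hs.2.le.trans hb)⟩), ← setIntegral_indicator measurableSet_Ioo]
  refine setIntegral_congr_fun measurableSet_Ioc fun s hs => ?_
  have := coe_mem_arc_iff hb (Ioc_subset_Icc_self hs)
  by_cases h : s ∈ Ioo a b
  · rw [indicator_of_mem h, indicator_of_mem (this.2 h)]
  · rw [indicator_of_notMem h, indicator_of_notMem (mt this.1 h)]

/-- The half wave `u` placed on the arc `(a, b)` and extended by zero. -/
def bump (a b : ℝ) (u : ℝ → ℝ) (x : UnitAddCircle) : ℝ :=
  u (max 0 ((b - a) / 2 - ‖x - (((a + b) / 2 : ℝ) : UnitAddCircle)‖))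

section Bump

variable {ε a b : ℝ} {u : ℝ → ℝ}

/-- `bump` evaluates `u` at the distance to the nearer endpoint; on the left half this is `s - a`,
on the right half the reflection `u (L - s) = u s` corrects it. -/
lemma bump_coe (hu : IsHalfWave ε (b - a) u) (hab : b ≤ a + 1) {s : ℝ} (hs : s ∈ Icc a b) :
    bump a b u (s : UnitAddCircle) = u (s - a) := by
  have habs : |s - (a + b) / 2| ≤ |(1 : ℝ)| / 2 := by
    rw [abs_one, abs_le]; constructor <;> linarith [hs.1, hs.2]
  rw [bump, ← AddCircle.coe_sub, (AddCircle.norm_coe_eq_abs_iff 1 one_ne_zero).2 habs]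
  rcases le_total s ((a + b) / 2) with h | h
  · rw [abs_of_nonpos (by linarith), max_eq_right (by linarith [hs.1])]
    congr 1; ring
  · rw [abs_of_nonneg (by linarith), max_eq_right (by linarith [hs.2]),
      ← hu.apply_period_sub (s - a)]
    congr 1; ring

lemma bump_eq_zero (hu : IsHalfWave ε (b - a) u) {x : UnitAddCircle} (hx : x ∉ arc a b) :
    bump a b u x = 0 := by
  rw [bump, max_eq_left, hu.apply_zero]
  by_contra! hlt
  obtain ⟨s, rfl⟩ := QuotientAddGroup.mk_surjective x
  rw [← AddCircle.coe_sub, UnitAddCircle.norm_eq] at hlt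
  have := abs_lt.1 (sub_pos.1 hlt)
  refine hx ⟨s - round (s - (a + b) / 2), ⟨by linarith, by linarith⟩, ?_⟩
  simp

/-- The reason for defining `bump` through the norm: it is a composition of Lipschitz maps on the
whole circle, with no gluing at the endpoints. -/
lemma lipschitzWith_bump {K : NNReal} (hu : LipschitzWith K u) :
    LipschitzWith K (bump a b u) := by
  refine LipschitzWith.of_dist_le_mul fun x y => (hu.dist_le_mul _ _).trans ?_
  gcongr
  rw [Real.dist_eq, max_comm 0, max_comm 0]
  refine (abs_max_sub_max_le_abs _ _ _).trans ?_
  rw [sub_sub_sub_cancel_left]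
  refine (abs_norm_sub_norm_le _ _).trans ?_
  rw [sub_sub_sub_cancel_right, dist_comm, dist_eq_norm]

end Bump

lemma energy_neg (ε : ℝ) (w : UnitAddCircle → ℝ) (Ω : Set UnitAddCircle) :
    energy ε (-w) Ω = energy ε w Ω := by
  simp only [energy, circleDeriv_neg, Pi.neg_apply, doubleWell, neg_sq]

lemma IsW12Zero.neg {Ω : Set UnitAddCircle} {w : UnitAddCircle → ℝ} (hw : IsW12Zero Ω w) :
    IsW12Zero Ω (-w) :=
  ⟨hw.1.neg, fun x hx => by simp [hw.2 x hx]⟩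

lemma IsDirichletMinimizer.neg {ε : ℝ} {Ω : Set UnitAddCircle} {w : UnitAddCircle → ℝ}
    (hw : IsDirichletMinimizer ε Ω w) : IsDirichletMinimizer ε Ω (-w) :=
  ⟨hw.1.neg, fun v hv => by rw [energy_neg]; exact hw.2 v hv⟩

/-! ### Dirichlet minimizers on unions of arcs -/

/-- The points `q 0 < q 1 < ... < q N = q 0 + 1` cut the circle into `N` arcs. -/
structure IsPartition (N : ℕ) (q : ℕ → ℝ) : Prop where
  lt_succ : ∀ i < N, q i < q (i + 1)
  period : q N = q 0 + 1

/-- The union of the arcs from `q i` to `q (i + 1)` with `i ∈ S`. -/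
def arcUnion (q : ℕ → ℝ) (S : Finset ℕ) : Set UnitAddCircle :=
  ⋃ i ∈ S, arc (q i) (q (i + 1))

/-- The half waves `u i` placed on the arcs from `q i` to `q (i + 1)` with `i ∈ S`. -/
def bumpSum (q : ℕ → ℝ) (u : ℕ → ℝ → ℝ) (S : Finset ℕ) (x : UnitAddCircle) : ℝ :=
  ∑ i ∈ S, bump (q i) (q (i + 1)) (u i) x

namespace IsPartition

variable {N : ℕ} {q : ℕ → ℝ}

lemma le_of_le (hq : IsPartition N q) {i j : ℕ} (hij : i ≤ j) (hj : j ≤ N) : q i ≤ q j := by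
  induction j, hij using Nat.le_induction with
  | base => exact le_rfl
  | succ j hij ih => exact (ih (by omega)).trans (hq.lt_succ j (by omega)).le

lemma le_add_one (hq : IsPartition N q) {i : ℕ} (hi : i < N) : q (i + 1) ≤ q i + 1 := by
  have h1 := hq.le_of_le (show i + 1 ≤ N from hi) le_rfl
  have h2 := hq.le_of_le (Nat.zero_le i) hi.le
  linarith [hq.period]

/-- Both lifts lie in one period `[q 0, q 0 + 1]` and `s` is interior to it, so they differ by less
than a full turn. -/
lemma eq_of_coe_eq (hq : IsPartition N q) {i j : ℕ} (hi : i < N) (hj : j < N) {s r : ℝ}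
    (hs : s ∈ Ioo (q i) (q (i + 1))) (hr : r ∈ Icc (q j) (q (j + 1)))
    (h : (s : UnitAddCircle) = (r : UnitAddCircle)) : s = r ∧ i = j := by
  have h1 := hq.le_of_le (Nat.zero_le i) hi.le
  have h2 := hq.le_of_le (show i + 1 ≤ N from hi) le_rfl
  have h3 := hq.le_of_le (Nat.zero_le j) hj.le
  have h4 := hq.le_of_le (show j + 1 ≤ N from hj) le_rfl
  have hp := hq.period
  obtain rfl := coe_eq_of_abs_sub_lt h
    (by rw [abs_lt]; constructor <;> linarith [hs.1, hs.2, hr.1, hr.2])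
  refine ⟨rfl, ?_⟩
  rcases lt_trichotomy i j with hij | hij | hij
  · linarith [hq.le_of_le (show i + 1 ≤ j from hij) hj.le, hs.2, hr.1]
  · exact hij
  · linarith [hq.le_of_le (show j + 1 ≤ i from hij) hi.le, hs.1, hr.2]

lemma exists_coe_eq (hq : IsPartition N q) (x : UnitAddCircle) :
    ∃ i < N, ∃ s ∈ Ico (q i) (q (i + 1)), (s : UnitAddCircle) = x := by
  have hx : x ∈ ((↑) : ℝ → UnitAddCircle) '' Ico (q 0) (q 0 + 1) := by
    rw [AddCircle.coe_image_Ico_eq]; trivial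
  obtain ⟨s, hs, rfl⟩ := hx
  rw [← hq.period] at hs
  have key : ∀ n, s ∈ Ico (q 0) (q n) → ∃ i < n, s ∈ Ico (q i) (q (i + 1)) := by
    intro n
    induction n with
    | zero => intro h; exact absurd h.2 (not_lt.2 h.1)
    | succ n ih =>
      intro h
      rcases lt_or_ge s (q n) with h1 | h1
      · obtain ⟨i, hi, hi'⟩ := ih ⟨h.1, h1⟩
        exact ⟨i, hi.trans n.lt_succ_self, hi'⟩
      · exact ⟨n, n.lt_succ_self, h1, h.2⟩
  obtain ⟨i, hi, hi'⟩ := key N hs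
  exact ⟨i, hi, s, hi', rfl⟩

lemma disjoint_arc (hq : IsPartition N q) {i j : ℕ} (hi : i < N) (hj : j < N) (hij : i ≠ j) :
    Disjoint (arc (q i) (q (i + 1))) (arc (q j) (q (j + 1))) := by
  rw [Set.disjoint_left]
  rintro _ ⟨s, hs, rfl⟩ ⟨r, hr, hrs⟩
  exact hij (hq.eq_of_coe_eq hi hj hs (Ioo_subset_Icc_self hr) hrs.symm).2

variable {S : Finset ℕ}

lemma coe_mem_arcUnion_iff (hq : IsPartition N q) (hS : ∀ i ∈ S, i < N) {j : ℕ} (hj : j < N)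
    {s : ℝ} (hs : s ∈ Icc (q j) (q (j + 1))) :
    (s : UnitAddCircle) ∈ arcUnion q S ↔ j ∈ S ∧ s ∈ Ioo (q j) (q (j + 1)) := by
  simp only [arcUnion, mem_iUnion₂]
  constructor
  · rintro ⟨i, hi, r, hr, hrs⟩
    obtain ⟨rfl, rfl⟩ := hq.eq_of_coe_eq (hS i hi) hj hr hs hrs
    exact ⟨hi, hr⟩
  · rintro ⟨h1, h2⟩
    exact ⟨j, h1, s, h2, rfl⟩

lemma isOpen_arcUnion (q : ℕ → ℝ) (S : Finset ℕ) : IsOpen (arcUnion q S) :=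
  isOpen_biUnion fun _ _ => isOpen_arc _ _

lemma energy_arcUnion (hq : IsPartition N q) (hS : ∀ i ∈ S, i < N) {w : UnitAddCircle → ℝ}
    (hw : IsW12 w) (ε : ℝ) :
    energy ε w (arcUnion q S) = ∑ i ∈ S, ∫ s in q i..q (i + 1),
      (ε / 2 * circleDeriv w (s : UnitAddCircle) ^ 2
        + 1 / ε * doubleWell (w (s : UnitAddCircle))) := by
  rw [energy, arcUnion, integral_biUnion_finset S (fun i _ => (isOpen_arc _ _).measurableSet)
    (fun i hi j hj hij => hq.disjoint_arc (hS i hi) (hS j hj) hij)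
    (fun i _ => (hw.integrable_energy ε).integrableOn)]
  exact Finset.sum_congr rfl fun i hi =>
    setIntegral_arc (hq.lt_succ i (hS i hi)).le (hq.le_add_one (hS i hi)) _

lemma energy_univ (hq : IsPartition N q) {w : UnitAddCircle → ℝ} (hw : IsW12 w) (ε : ℝ) :
    energy ε w univ = ∑ i ∈ Finset.range N, ∫ s in q i..q (i + 1),
      (ε / 2 * circleDeriv w (s : UnitAddCircle) ^ 2
        + 1 / ε * doubleWell (w (s : UnitAddCircle))) := by
  rw [energy, setIntegral_univ, ← UnitAddCircle.intervalIntegral_preimage (q 0), ← hq.period]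
  exact (intervalIntegral.sum_integral_adjacent_intervals fun i _ =>
    intervalIntegrable_coe (hw.integrable_energy ε) _ _).symm

variable {ε : ℝ} {u : ℕ → ℝ → ℝ}

lemma bumpSum_eq_zero (hu : ∀ i < N, IsHalfWave ε (q (i + 1) - q i) (u i))
    (hS : ∀ i ∈ S, i < N) {x : UnitAddCircle} (hx : x ∉ arcUnion q S) :
    bumpSum q u S x = 0 :=
  Finset.sum_eq_zero fun i hi => bump_eq_zero (hu i (hS i hi)) fun h =>
    hx (mem_iUnion₂.2 ⟨i, hi, h⟩)

lemma bumpSum_coe (hq : IsPartition N q) (hu : ∀ i < N, IsHalfWave ε (q (i + 1) - q i) (u i))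
    (hS : ∀ i ∈ S, i < N) {i : ℕ} (hi : i ∈ S) {s : ℝ} (hs : s ∈ Icc (q i) (q (i + 1))) :
    bumpSum q u S (s : UnitAddCircle) = u i (s - q i) := by
  rw [bumpSum, Finset.sum_eq_single_of_mem i hi]
  · exact bump_coe (hu i (hS i hi)) (hq.le_add_one (hS i hi)) hs
  · intro j hj hji
    refine bump_eq_zero (hu j (hS j hj)) ?_
    rintro ⟨r, hr, hrs⟩
    exact hji (hq.eq_of_coe_eq (hS j hj) (hS i hi) hr hs hrs).2

lemma bumpSum_pos (hq : IsPartition N q) (hu : ∀ i < N, IsHalfWave ε (q (i + 1) - q i) (u i))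
    (hS : ∀ i ∈ S, i < N) {x : UnitAddCircle} (hx : x ∈ arcUnion q S) : 0 < bumpSum q u S x := by
  obtain ⟨i, hi, s, hs, rfl⟩ := mem_iUnion₂.1 hx
  have := hq.bumpSum_coe hu hS hi (Ioo_subset_Icc_self hs)
  simp only at this ⊢
  rw [this]
  exact (hu i (hS i hi)).pos _ ⟨by linarith [hs.1], by linarith [hs.2]⟩

lemma exists_lipschitzWith_bumpSum (hu : ∀ i < N, IsHalfWave ε (q (i + 1) - q i) (u i))
    (hS : ∀ i ∈ S, i < N) : ∃ K, LipschitzWith K (bumpSum q u S) := by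
  classical
  induction S using Finset.induction_on with
  | empty => exact ⟨0, by unfold bumpSum; simp⟩
  | insert i S hi ih =>
    obtain ⟨K, hK⟩ := ih fun j hj => hS j (Finset.mem_insert_of_mem hj)
    obtain ⟨C, hC⟩ := (hu i (hS i (Finset.mem_insert_self i S))).lipschitz
    refine ⟨C + K, ?_⟩
    have : bumpSum q u (insert i S) =
        fun x => bump (q i) (q (i + 1)) (u i) x + bumpSum q u S x :=
      funext fun x => Finset.sum_insert hi
    rw [this]
    exact (lipschitzWith_bump hC).add hK

lemma isW12Zero_bumpSum (hu : ∀ i < N, IsHalfWave ε (q (i + 1) - q i) (u i))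
    (hS : ∀ i ∈ S, i < N) : IsW12Zero (arcUnion q S) (bumpSum q u S) := by
  obtain ⟨K, hK⟩ := exists_lipschitzWith_bumpSum hu hS
  exact ⟨isW12_of_lipschitzWith hK, fun x hx => bumpSum_eq_zero hu hS hx⟩

lemma energy_bumpSum (hq : IsPartition N q) (hε : 0 < ε)
    (hu : ∀ i < N, IsHalfWave ε (q (i + 1) - q i) (u i)) (hS : ∀ i ∈ S, i < N) :
    energy ε (bumpSum q u S) (arcUnion q S) =
      ∑ i ∈ S, ∫ s in (0 : ℝ)..(q (i + 1) - q i), (1 - u i s ^ 4) / (4 * ε) := by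
  rw [hq.energy_arcUnion hS (isW12Zero_bumpSum hu hS).1]
  refine Finset.sum_congr rfl fun i hi => ?_
  exact integral_energy_of_eqOn (σ := 1) (hu i (hS i hi)) hε.ne' (hq.lt_succ i (hS i hi)).le
    (by norm_num) fun s hs => by
      rw [hq.bumpSum_coe hu hS hi (Ioo_subset_Icc_self hs), one_mul]

/-- The calibration summed over the arcs. The defect is kept: its sign gives minimality, its
vanishing gives uniqueness. -/
lemma le_energy (hq : IsPartition N q) (hε : 0 < ε)
    (hu : ∀ i < N, IsHalfWave ε (q (i + 1) - q i) (u i)) (hS : ∀ i ∈ S, i < N)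
    {w : UnitAddCircle → ℝ} (hw : IsW12Zero (arcUnion q S) w) :
    energy ε (bumpSum q u S) (arcUnion q S) +
      ∑ i ∈ S, ∫ s in (0 : ℝ)..(q (i + 1) - q i),
        (w ((q i + s : ℝ) : UnitAddCircle) ^ 2 - u i s ^ 2) ^ 2 / (4 * ε) ≤
      energy ε w (arcUnion q S) := by
  rw [hq.energy_bumpSum hε hu hS, hq.energy_arcUnion hS hw.1, ← Finset.sum_add_distrib]
  refine Finset.sum_le_sum fun i hi => ?_
  have hlt := hq.lt_succ i (hS i hi)
  refine hw.1.integral_le_energy (hu i (hS i hi)) hε hlt (hw.2 _ ?_) (hw.2 _ ?_)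
  · rw [hq.coe_mem_arcUnion_iff hS (hS i hi) (left_mem_Icc.2 hlt.le)]
    exact fun h => lt_irrefl _ h.2.1
  · rw [hq.coe_mem_arcUnion_iff hS (hS i hi) (right_mem_Icc.2 hlt.le)]
    exact fun h => lt_irrefl _ h.2.2

lemma isDirichletMinimizer_bumpSum (hq : IsPartition N q) (hε : 0 < ε)
    (hu : ∀ i < N, IsHalfWave ε (q (i + 1) - q i) (u i)) (hS : ∀ i ∈ S, i < N) :
    IsDirichletMinimizer ε (arcUnion q S) (bumpSum q u S) := by
  refine ⟨isW12Zero_bumpSum hu hS, fun w hw => le_trans ?_ (hq.le_energy hε hu hS hw)⟩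
  refine le_add_of_nonneg_right (Finset.sum_nonneg fun i hi => ?_)
  exact intervalIntegral.integral_nonneg (sub_nonneg.2 (hq.lt_succ i (hS i hi)).le)
    fun s _ => by positivity

/-- Dirichlet minimizers are unique up to sign. -/
lemma sq_eq_of_isDirichletMinimizer (hq : IsPartition N q) (hε : 0 < ε)
    (hu : ∀ i < N, IsHalfWave ε (q (i + 1) - q i) (u i)) (hS : ∀ i ∈ S, i < N)
    {w : UnitAddCircle → ℝ} (hw : IsDirichletMinimizer ε (arcUnion q S) w) (x : UnitAddCircle) :
    w x ^ 2 = bumpSum q u S x ^ 2 := by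
  by_cases hx : x ∉ arcUnion q S
  · rw [hw.1.2 x hx, bumpSum_eq_zero hu hS hx]
  obtain ⟨i, hi, s, hs, rfl⟩ := mem_iUnion₂.1 (not_not.1 hx)
  have hnn : ∀ j ∈ S, 0 ≤ ∫ s in (0 : ℝ)..(q (j + 1) - q j),
      (w ((q j + s : ℝ) : UnitAddCircle) ^ 2 - u j s ^ 2) ^ 2 / (4 * ε) := fun j hj =>
    intervalIntegral.integral_nonneg (sub_nonneg.2 (hq.lt_succ j (hS j hj)).le)
      fun s _ => by positivity
  have hle := hq.le_energy hε hu hS hw.1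
  have hmin := hw.2 _ (isW12Zero_bumpSum hu hS)
  have hzero := Finset.single_le_sum hnn hi
  by_contra hne
  have hb := hq.bumpSum_coe hu hS hi (Ioo_subset_Icc_self hs)
  simp only at hne
  rw [hb] at hne
  -- If the squares differ at one point, continuity makes the defect on that arc positive, against
  -- minimality of `w`.
  refine absurd (intervalIntegral.integral_pos (sub_pos.2 (hq.lt_succ i (hS i hi)))
    (f := fun s => (w ((q i + s : ℝ) : UnitAddCircle) ^ 2 - u i s ^ 2) ^ 2 / (4 * ε))
    (Continuous.continuousOn ?_) (fun s _ => by positivity)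
    ⟨s - q i, ⟨by linarith [hs.1], by linarith [hs.2]⟩, ?_⟩) (not_lt.2 ?_)
  · have h1 := hw.1.1.continuous_coe.comp (continuous_const_add (q i))
    have h2 := (hu i (hS i hi)).continuous
    exact ((h1.pow 2).sub (h2.pow 2)).pow 2 |>.div_const _
  · rw [add_sub_cancel]
    have := sub_ne_zero.2 hne
    positivity
  · linarith

lemma eq_bumpSum_of_pos (hq : IsPartition N q) (hε : 0 < ε)
    (hu : ∀ i < N, IsHalfWave ε (q (i + 1) - q i) (u i)) (hS : ∀ i ∈ S, i < N)
    {w : UnitAddCircle → ℝ} (hw : IsDirichletMinimizer ε (arcUnion q S) w)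
    (hpos : ∀ x ∈ arcUnion q S, 0 < w x) : w = bumpSum q u S := by
  funext x
  by_cases hx : x ∈ arcUnion q S
  · exact (sq_eq_sq₀ (hpos x hx).le (hq.bumpSum_pos hu hS hx).le).1
      (hq.sq_eq_of_isDirichletMinimizer hε hu hS hw x)
  · rw [hw.1.2 x hx, bumpSum_eq_zero hu hS hx]

/-! ### The broken phase transition -/

/-- The indices of the positive arcs. -/
abbrev evens (N : ℕ) : Finset ℕ := (Finset.range N).filter Even

/-- The indices of the negative arcs. -/
abbrev odds (N : ℕ) : Finset ℕ := (Finset.range N).filter fun i => ¬ Even i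

lemma lt_of_mem_evens {i : ℕ} (hi : i ∈ evens N) : i < N :=
  Finset.mem_range.1 (Finset.mem_filter.1 hi).1

lemma lt_of_mem_odds {i : ℕ} (hi : i ∈ odds N) : i < N :=
  Finset.mem_range.1 (Finset.mem_filter.1 hi).1

lemma coe_mem_closure_arcUnion (hq : IsPartition N q) {i : ℕ} (hi : i ∈ evens N) {s : ℝ}
    (hs : s ∈ Icc (q i) (q (i + 1))) : (s : UnitAddCircle) ∈ closure (arcUnion q (evens N)) := by
  rw [← closure_Ioo (hq.lt_succ i (lt_of_mem_evens hi)).ne] at hs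
  have h1 := image_closure_subset_closure_image (AddCircle.continuous_mk' (1 : ℝ))
    (mem_image_of_mem _ hs)
  exact closure_mono (subset_biUnion_of_mem (u := fun i => arc (q i) (q (i + 1))) hi) h1

lemma compl_closure_arcUnion (hq : IsPartition N q) :
    (closure (arcUnion q (evens N)))ᶜ = arcUnion q (odds N) := by
  ext x
  constructor
  · intro hx
    obtain ⟨i, hi, s, hs, rfl⟩ := hq.exists_coe_eq x
    have hodd : ¬ Even i := fun he => hx (hq.coe_mem_closure_arcUnion
      (Finset.mem_filter.2 ⟨Finset.mem_range.2 hi, he⟩) (Ico_subset_Icc_self hs))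
    refine mem_iUnion₂.2 ⟨i, Finset.mem_filter.2 ⟨Finset.mem_range.2 hi, hodd⟩, s,
      ⟨hs.1.lt_of_ne ?_, hs.2⟩, rfl⟩
    -- The left endpoint of an odd arc is the right endpoint of the preceding even arc, so it lies
    -- in the closure; oddness excludes the index `0`.
    rintro rfl
    obtain ⟨j, rfl⟩ : ∃ j, i = j + 1 :=
      Nat.exists_eq_succ_of_ne_zero (by rintro rfl; exact hodd Even.zero)
    have hj : j ∈ evens N := Finset.mem_filter.2
      ⟨Finset.mem_range.2 (by omega), by simpa [Nat.even_add_one] using hodd⟩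
    exact hx (hq.coe_mem_closure_arcUnion hj
      (right_mem_Icc.2 (hq.lt_succ j (lt_of_mem_evens hj)).le))
  · intro hx hcl
    have hd : Disjoint (arcUnion q (evens N)) (arcUnion q (odds N)) := by
      simp only [arcUnion, disjoint_iUnion₂_left, disjoint_iUnion₂_right]
      intro j hj i hi
      refine hq.disjoint_arc (lt_of_mem_evens hi) (lt_of_mem_odds hj) ?_
      rintro rfl
      exact (Finset.mem_filter.1 hj).2 (Finset.mem_filter.1 hi).2
    exact Set.disjoint_left.1 (hd.closure_left (isOpen_arcUnion q _)) hcl hx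

/-- Existence and uniqueness at once. The energy is even in `u`, so the negative minimizer is the
negative of the positive one on the odd arcs. -/
lemma isBrokenPhaseTransition_iff (hq : IsPartition N q) (hε : 0 < ε)
    (hu : ∀ i < N, IsHalfWave ε (q (i + 1) - q i) (u i)) (U : UnitAddCircle → ℝ) :
    IsBrokenPhaseTransition ε (arcUnion q (evens N)) U ↔
      U = bumpSum q u (evens N) - bumpSum q u (odds N) := by
  have hE : ∀ i ∈ evens N, i < N := fun i => lt_of_mem_evens
  have hO : ∀ i ∈ odds N, i < N := fun i => lt_of_mem_odds
  have hzeroO : ∀ x ∈ closure (arcUnion q (evens N)), bumpSum q u (odds N) x = 0 := by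
    intro x hx
    refine bumpSum_eq_zero hu hO ?_
    rw [← hq.compl_closure_arcUnion]
    exact not_not.2 hx
  have hzeroE : ∀ x ∈ (closure (arcUnion q (evens N)))ᶜ, bumpSum q u (evens N) x = 0 :=
    fun x hx => bumpSum_eq_zero hu hE fun h => hx (subset_closure h)
  constructor
  · rintro ⟨v, w, ⟨hv, hv'⟩, ⟨hw, hw'⟩, h1, h2⟩
    rw [hq.compl_closure_arcUnion] at hw hw'
    have ev := hq.eq_bumpSum_of_pos hε hu hE hv hv'
    have ew := hq.eq_bumpSum_of_pos hε hu hO hw.neg fun x hx => neg_pos.2 (hw' x hx)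
    funext x
    by_cases hx : x ∈ closure (arcUnion q (evens N))
    · rw [h1 x hx, ev, Pi.sub_apply, hzeroO x hx, sub_zero]
    · rw [h2 x hx, Pi.sub_apply, hzeroE x hx, ← ew, Pi.neg_apply]
      ring
  · rintro rfl
    refine ⟨bumpSum q u (evens N), -bumpSum q u (odds N),
      ⟨hq.isDirichletMinimizer_bumpSum hε hu hE, fun x hx => hq.bumpSum_pos hu hE hx⟩,
      ⟨?_, ?_⟩, fun x hx => ?_, fun x hx => ?_⟩
    · rw [hq.compl_closure_arcUnion]
      exact (hq.isDirichletMinimizer_bumpSum hε hu hO).neg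
    · rw [hq.compl_closure_arcUnion]
      exact fun x hx => neg_neg_iff_pos.2 (hq.bumpSum_pos hu hO hx)
    · rw [Pi.sub_apply, hzeroO x hx, sub_zero]
    · rw [Pi.sub_apply, hzeroE x hx, Pi.neg_apply, zero_sub]

lemma bumpSum_sub_bumpSum_coe (hq : IsPartition N q)
    (hu : ∀ i < N, IsHalfWave ε (q (i + 1) - q i) (u i)) {i : ℕ} (hi : i < N) {s : ℝ}
    (hs : s ∈ Icc (q i) (q (i + 1))) :
    (bumpSum q u (evens N) - bumpSum q u (odds N)) (s : UnitAddCircle) =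
      (-1) ^ i * u i (s - q i) := by
  have hE : ∀ i ∈ evens N, i < N := fun i => lt_of_mem_evens
  have hO : ∀ i ∈ odds N, i < N := fun i => lt_of_mem_odds
  rw [Pi.sub_apply]
  by_cases he : Even i
  · rw [hq.bumpSum_coe hu hE (Finset.mem_filter.2 ⟨Finset.mem_range.2 hi, he⟩) hs,
      bumpSum_eq_zero hu hO, he.neg_one_pow]
    · ring
    · rw [hq.coe_mem_arcUnion_iff hO hi hs]
      exact fun h => (Finset.mem_filter.1 h.1).2 he
  · rw [hq.bumpSum_coe hu hO (Finset.mem_filter.2 ⟨Finset.mem_range.2 hi, he⟩) hs,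
      bumpSum_eq_zero hu hE, (Nat.not_even_iff_odd.1 he).neg_one_pow]
    · ring
    · rw [hq.coe_mem_arcUnion_iff hE hi hs]
      exact fun h => he (Finset.mem_filter.1 h.1).2

lemma balancedEnergy_eq (hq : IsPartition N q) (hε : 0 < ε)
    (hu : ∀ i < N, IsHalfWave ε (q (i + 1) - q i) (u i)) :
    balancedEnergy ε (arcUnion q (evens N)) = ∑ i ∈ Finset.range N,
      ∫ s in (0 : ℝ)..(q (i + 1) - q i), (1 - u i s ^ 4) / (4 * ε) := by
  have hE : ∀ i ∈ evens N, i < N := fun i => lt_of_mem_evens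
  have hO : ∀ i ∈ odds N, i < N := fun i => lt_of_mem_odds
  have hex : ∃ U, IsBrokenPhaseTransition ε (arcUnion q (evens N)) U :=
    ⟨_, (hq.isBrokenPhaseTransition_iff hε hu _).2 rfl⟩
  rw [balancedEnergy, brokenPhaseTransition, dif_pos hex,
    (hq.isBrokenPhaseTransition_iff hε hu _).1 hex.choose_spec]
  obtain ⟨K, hK⟩ := exists_lipschitzWith_bumpSum hu hE
  obtain ⟨C, hC⟩ := exists_lipschitzWith_bumpSum hu hO
  have hW : IsW12 (bumpSum q u (evens N) - bumpSum q u (odds N)) :=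
    isW12_of_lipschitzWith (hK.sub hC)
  rw [hq.energy_univ hW]
  refine Finset.sum_congr rfl fun i hi => ?_
  rw [Finset.mem_range] at hi
  exact integral_energy_of_eqOn (σ := (-1) ^ i) (hu i hi) hε.ne' (hq.lt_succ i hi).le
    (by rw [← pow_mul, mul_comm, pow_mul]; norm_num)
    fun s hs => hq.bumpSum_sub_bumpSum_coe hu hi (Ioo_subset_Icc_self hs)

end IsPartition

/-! ### Length and energy as functions of the amplitude -/

lemma hasDerivAt_intervalIntegral_of_continuousOn {g g' : ℝ → ℝ → ℝ} {s : Set ℝ} (hs : IsOpen s)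
    {k a b : ℝ} (hk : k ∈ s) (hg : ∀ k ∈ s, Continuous (g k))
    (hg' : ContinuousOn (fun p : ℝ × ℝ => g' p.1 p.2) (s ×ˢ univ))
    (hd : ∀ k ∈ s, ∀ θ, HasDerivAt (fun k => g k θ) (g' k θ) k) :
    HasDerivAt (fun k => ∫ θ in a..b, g k θ) (∫ θ in a..b, g' k θ) k := by
  -- Compactness of a parameter ball times `[a, b]` supplies a constant dominating function.
  obtain ⟨r, hr, hrs⟩ := Metric.nhds_basis_closedBall.mem_iff.1 (hs.mem_nhds hk)
  obtain ⟨C, hC⟩ := ((isCompact_closedBall k r).prod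
    (isCompact_uIcc (a := a) (b := b))).exists_bound_of_continuousOn
    (hg'.mono (prod_mono hrs (subset_univ _)))
  refine (intervalIntegral.hasDerivAt_integral_of_dominated_loc_of_deriv_le (F := g) (F' := g')
    (bound := fun _ => C) (Metric.closedBall_mem_nhds k hr) ?_ ((hg k hk).intervalIntegrable _ _)
    ?_ ?_ (by simp) ?_).2
  · filter_upwards [hs.mem_nhds hk] with x hx using (hg x hx).aestronglyMeasurable
  · have : Continuous (g' k) := by
      refine continuousOn_univ.1 ?_
      exact hg'.comp (f := fun θ => (k, θ)) (by fun_prop) fun θ _ => ⟨hk, trivial⟩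
    exact this.aestronglyMeasurable
  · exact Eventually.of_forall fun θ hθ x hx => hC (x, θ) ⟨hx, uIoc_subset_uIcc hθ⟩
  · exact Eventually.of_forall fun θ _ x hx => hd x (hrs hx) θ

lemma disc_pos_of_lt_one {k : ℝ} (hk : k < 1) (θ : ℝ) : 0 < disc k θ := by
  rcases le_total 0 k with h | h
  · exact disc_pos h hk θ
  · have := sq_nonneg (Real.sin θ)
    unfold disc; nlinarith

lemma continuous_disc_uncurry : Continuous fun p : ℝ × ℝ => disc p.1 p.2 := by
  unfold disc; fun_prop

lemma hasDerivAt_inv_sqrt_disc {k : ℝ} (hk : k < 1) (θ : ℝ) :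
    HasDerivAt (fun k => 1 / √(disc k θ))
      ((1 + Real.sin θ ^ 2) / (2 * disc k θ * √(disc k θ))) k := by
  have hd := disc_pos_of_lt_one hk θ
  have h1 : HasDerivAt (fun k => disc k θ) (-(1 + Real.sin θ ^ 2)) k := by
    have := ((hasDerivAt_id k).const_sub 2).sub ((hasDerivAt_id k).mul_const (Real.sin θ ^ 2))
    refine this.congr_deriv ?_
    ring
  have hq := Real.sqrt_pos.2 hd
  refine ((hasDerivAt_const k (1 : ℝ)).div (h1.sqrt hd.ne') hq.ne').congr_deriv ?_
  rw [Real.sq_sqrt hd.le]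
  field_simp
  ring

/-- The normalized distance between zeros of the profile of squared amplitude `k`. -/
def periodIntegral (k : ℝ) : ℝ := ∫ θ in (0 : ℝ)..Real.pi, 1 / √(disc k θ)

/-- The derivative of the normalized distance between zeros. -/
def periodIntegralDeriv (k : ℝ) : ℝ :=
  ∫ θ in (0 : ℝ)..Real.pi, (1 + Real.sin θ ^ 2) / (2 * disc k θ * √(disc k θ))

/-- The normalized energy of the profile of squared amplitude `k`. -/
def energyIntegral (k : ℝ) : ℝ :=
  ∫ θ in (0 : ℝ)..Real.pi, (1 - k ^ 2 * Real.sin θ ^ 4) * (1 / √(disc k θ))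

lemma continuous_inv_sqrt_disc {k : ℝ} (hk : k < 1) : Continuous fun θ => 1 / √(disc k θ) :=
  continuous_const.div (continuous_disc k).sqrt
    fun θ => (Real.sqrt_pos.2 (disc_pos_of_lt_one hk θ)).ne'

lemma continuousOn_inv_sqrt_disc :
    ContinuousOn (fun p : ℝ × ℝ => 1 / √(disc p.1 p.2)) (Iio 1 ×ˢ univ) :=
  continuousOn_const.div continuous_disc_uncurry.sqrt.continuousOn
    fun p hp => (Real.sqrt_pos.2 (disc_pos_of_lt_one hp.1 p.2)).ne'

lemma continuousOn_deriv_inv_sqrt_disc :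
    ContinuousOn (fun p : ℝ × ℝ => (1 + Real.sin p.2 ^ 2) /
      (2 * disc p.1 p.2 * √(disc p.1 p.2))) (Iio 1 ×ˢ univ) := by
  have h := continuous_disc_uncurry
  refine ContinuousOn.div (by fun_prop) (Continuous.continuousOn (by fun_prop)) fun p hp => ?_
  have h1 := disc_pos_of_lt_one hp.1 p.2
  have h2 := Real.sqrt_pos.2 h1
  positivity

lemma hasDerivAt_periodIntegral {k : ℝ} (hk : k < 1) :
    HasDerivAt periodIntegral (periodIntegralDeriv k) k :=
  hasDerivAt_intervalIntegral_of_continuousOn isOpen_Iio hk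
    (fun _ h => continuous_inv_sqrt_disc h) continuousOn_deriv_inv_sqrt_disc
    fun _ h θ => hasDerivAt_inv_sqrt_disc h θ

lemma continuous_deriv_inv_sqrt_disc {k : ℝ} (hk : k < 1) :
    Continuous fun θ => (1 + Real.sin θ ^ 2) / (2 * disc k θ * √(disc k θ)) :=
  continuousOn_univ.1 (continuousOn_deriv_inv_sqrt_disc.comp (f := fun θ => (k, θ))
    (by fun_prop) fun _ _ => ⟨hk, trivial⟩)

lemma periodIntegralDeriv_pos {k : ℝ} (hk : k < 1) : 0 < periodIntegralDeriv k := by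
  refine intervalIntegral.intervalIntegral_pos_of_pos
    ((continuous_deriv_inv_sqrt_disc hk).intervalIntegrable _ _) (fun θ => ?_) Real.pi_pos
  have h1 := disc_pos_of_lt_one hk θ
  have h2 := Real.sqrt_pos.2 h1
  positivity

/-- The two integrands differ by a total `θ`-derivative that integrates to zero over `[0, π]`. The
factor `(1 - k)²` is four times the potential `W(√k)` at the crest. -/
lemma hasDerivAt_energyIntegral {k : ℝ} (hk : k < 1) :
    HasDerivAt energyIntegral ((1 - k) ^ 2 * periodIntegralDeriv k) k := by
  have hmain : HasDerivAt energyIntegral (∫ θ in (0 : ℝ)..Real.pi,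
      (-(2 * k * Real.sin θ ^ 4) * (1 / √(disc k θ)) + (1 - k ^ 2 * Real.sin θ ^ 4) *
        ((1 + Real.sin θ ^ 2) / (2 * disc k θ * √(disc k θ))))) k := by
    refine hasDerivAt_intervalIntegral_of_continuousOn
      (g := fun k θ => (1 - k ^ 2 * Real.sin θ ^ 4) * (1 / √(disc k θ)))
      (g' := fun k θ => -(2 * k * Real.sin θ ^ 4) * (1 / √(disc k θ)) +
        (1 - k ^ 2 * Real.sin θ ^ 4) *
          ((1 + Real.sin θ ^ 2) / (2 * disc k θ * √(disc k θ)))) isOpen_Iio hk ?_ ?_ ?_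
    · exact fun k h => Continuous.mul (by fun_prop) (continuous_inv_sqrt_disc h)
    · exact (ContinuousOn.mul (by fun_prop) continuousOn_inv_sqrt_disc).add
        (ContinuousOn.mul (by fun_prop) continuousOn_deriv_inv_sqrt_disc)
    · intro k h θ
      refine (((((hasDerivAt_id k).pow 2).mul_const (Real.sin θ ^ 4)).const_sub 1).mul
        (hasDerivAt_inv_sqrt_disc h θ)).congr_deriv ?_
      simp
  refine hmain.congr_deriv ?_
  have hi1 := continuous_inv_sqrt_disc hk
  have hi2 := continuous_deriv_inv_sqrt_disc hk
  have hc1 : Continuous fun θ => -(2 * k * Real.sin θ ^ 4) * (1 / √(disc k θ)) +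
      (1 - k ^ 2 * Real.sin θ ^ 4) * ((1 + Real.sin θ ^ 2) / (2 * disc k θ * √(disc k θ))) :=
    (Continuous.mul (by fun_prop) hi1).add (Continuous.mul (by fun_prop) hi2)
  have hc2 : Continuous fun θ => (1 - k) ^ 2 *
      ((1 + Real.sin θ ^ 2) / (2 * disc k θ * √(disc k θ))) := continuous_const.mul hi2
  -- The primitive of the difference; it carries the factor `sin θ` and so vanishes at `0` and `π`.
  have hd : ∀ θ, HasDerivAt
      (fun θ => k / 2 * (Real.sin θ * Real.cos θ * (1 + Real.sin θ ^ 2)) / √(disc k θ))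
      (-(2 * k * Real.sin θ ^ 4) * (1 / √(disc k θ)) + (1 - k ^ 2 * Real.sin θ ^ 4) *
        ((1 + Real.sin θ ^ 2) / (2 * disc k θ * √(disc k θ))) -
        (1 - k) ^ 2 * ((1 + Real.sin θ ^ 2) / (2 * disc k θ * √(disc k θ)))) θ := by
    intro θ
    have hp := disc_pos_of_lt_one hk θ
    have hq := Real.sqrt_pos.2 hp
    refine ((((Real.hasDerivAt_sin θ).mul (Real.hasDerivAt_cos θ)).mul
      (((Real.hasDerivAt_sin θ).pow 2).const_add 1)).const_mul (k / 2)).div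
      ((hasDerivAt_disc k θ).sqrt hp.ne') hq.ne' |>.congr_deriv ?_
    have e2 : √(disc k θ) ^ 2 = disc k θ := Real.sq_sqrt hp.le
    have e5 : Real.cos θ ^ 2 = 1 - Real.sin θ ^ 2 := by
      linarith [Real.sin_sq_add_cos_sq θ]
    have e1 : disc k θ = 2 - k - k * Real.sin θ ^ 2 := rfl
    generalize hdd : √(disc k θ) = d at *
    rw [← e2] at hp ⊢
    simp only [Pi.mul_apply, Pi.pow_apply]
    field_simp
    rw [e5, e2, e1]
    norm_num
    ring
  have hz := intervalIntegral.integral_eq_sub_of_hasDerivAt (fun θ _ => hd θ)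
    ((hc1.sub hc2).intervalIntegrable 0 Real.pi)
  rw [intervalIntegral.integral_sub (hc1.intervalIntegrable _ _) (hc2.intervalIntegrable _ _),
    intervalIntegral.integral_const_mul] at hz
  simp only [Real.sin_pi, Real.sin_zero, zero_mul, mul_zero, zero_div, sub_zero] at hz
  exact sub_eq_zero.1 hz

lemma strictMonoOn_periodIntegral : StrictMonoOn periodIntegral (Iio 1) :=
  strictMonoOn_of_deriv_pos (convex_Iio 1)
    (fun _ hk => (hasDerivAt_periodIntegral hk).continuousAt.continuousWithinAt)
    fun k hk => by
      rw [interior_Iio] at hk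
      rw [(hasDerivAt_periodIntegral hk).deriv]
      exact periodIntegralDeriv_pos hk

lemma periodIntegral_zero : periodIntegral 0 = Real.pi / √2 := by
  simp [periodIntegral, disc, div_eq_mul_inv]

/-- Logarithmic divergence as `k → 1`: near `θ = π/2` the discriminant is `2(1 - k) + k cos² θ`,
which degenerates to a square. -/
lemma exists_le_periodIntegral (y : ℝ) : ∃ k ∈ Ioo (0 : ℝ) 1, y ≤ periodIntegral k := by
  -- With `k = 1 - a²/2` one has `√disc ≤ a + π/2 - θ`, so the integral is at least `log (a + π/2) -
  -- log a`, and `-log a = |y| + 1`.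
  set a := Real.exp (-(|y| + 1)) with ha
  have ha0 : 0 < a := Real.exp_pos _
  have ha1 : a < 1 := Real.exp_lt_one_iff.2 (by linarith [abs_nonneg y])
  have hk1 : 1 - a ^ 2 / 2 < 1 := by nlinarith
  have hk0 : 0 < 1 - a ^ 2 / 2 := by nlinarith
  refine ⟨1 - a ^ 2 / 2, ⟨hk0, hk1⟩, ?_⟩
  set k := 1 - a ^ 2 / 2 with hk
  have hπ := Real.pi_gt_three
  have hc := continuous_inv_sqrt_disc hk1
  have hpos : ∀ θ ∈ Icc 0 (Real.pi / 2), 0 < a + Real.pi / 2 - θ := fun θ hθ => by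
    linarith [hθ.2]
  have h1 : ∫ θ in (0 : ℝ)..(Real.pi / 2), 1 / (a + Real.pi / 2 - θ) =
      Real.log (a + Real.pi / 2) - Real.log a := by
    rw [intervalIntegral.integral_eq_sub_of_hasDerivAt
      (f := fun θ => -Real.log (a + Real.pi / 2 - θ))]
    · ring_nf
    · intro θ hθ
      rw [uIcc_of_le (by positivity)] at hθ
      refine (((hasDerivAt_id θ).const_sub (a + Real.pi / 2)).log
        (hpos θ hθ).ne').neg.congr_deriv ?_
      simp [neg_div]
    · refine ContinuousOn.intervalIntegrable (ContinuousOn.div (by fun_prop) (by fun_prop) ?_)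
      rw [uIcc_of_le (by positivity)]
      exact fun θ hθ => (hpos θ hθ).ne'
  have h2 : ∫ θ in (0 : ℝ)..(Real.pi / 2), 1 / (a + Real.pi / 2 - θ) ≤
      ∫ θ in (0 : ℝ)..(Real.pi / 2), 1 / √(disc k θ) := by
    refine intervalIntegral.integral_mono_on (by positivity) ?_ (hc.intervalIntegrable _ _) ?_
    · refine ContinuousOn.intervalIntegrable (ContinuousOn.div (by fun_prop) (by fun_prop) ?_)
      rw [uIcc_of_le (by positivity)]
      exact fun θ hθ => (hpos θ hθ).ne'
    · intro θ hθ
      have hq := Real.sqrt_pos.2 (disc_pos_of_lt_one hk1 θ)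
      refine one_div_le_one_div_of_le hq ?_
      rw [Real.sqrt_le_left (hpos θ hθ).le]
      have hcos : Real.cos θ ≤ Real.pi / 2 - θ := by
        rw [← Real.sin_pi_div_two_sub]
        exact Real.sin_le (by linarith [hθ.2])
      have hcos0 : 0 ≤ Real.cos θ := Real.cos_nonneg_of_mem_Icc ⟨by linarith [hθ.1], hθ.2⟩
      have hss := Real.sin_sq_add_cos_sq θ
      have hsq : Real.cos θ ^ 2 ≤ (Real.pi / 2 - θ) ^ 2 := pow_le_pow_left₀ hcos0 hcos 2
      have hdisc : disc k θ = a ^ 2 + k * Real.cos θ ^ 2 := by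
        unfold disc
        rw [show Real.sin θ ^ 2 = 1 - Real.cos θ ^ 2 by linarith, hk]
        ring
      rw [hdisc]
      nlinarith [mul_nonneg ha0.le (hcos0.trans hcos), sq_nonneg (Real.cos θ)]
  have h3 : ∫ θ in (0 : ℝ)..(Real.pi / 2), 1 / √(disc k θ) ≤ periodIntegral k := by
    refine intervalIntegral.integral_mono_interval le_rfl (by positivity)
      (by linarith) (Eventually.of_forall fun θ => ?_) (hc.intervalIntegrable _ _)
    positivity
  have h4 : Real.log a = -(|y| + 1) := Real.log_exp _
  have h5 : 0 ≤ Real.log (a + Real.pi / 2) := Real.log_nonneg (by linarith)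
  linarith [le_abs_self y]

lemma exists_periodIntegral_eq {y : ℝ} (hy : Real.pi / √2 < y) :
    ∃ k ∈ Ioo (0 : ℝ) 1, periodIntegral k = y := by
  obtain ⟨k, hk, hky⟩ := exists_le_periodIntegral y
  have hcont : ContinuousOn periodIntegral (Icc 0 k) := fun x hx =>
    (hasDerivAt_periodIntegral (hx.2.trans_lt hk.2)).continuousAt.continuousWithinAt
  obtain ⟨x, hx, rfl⟩ := intermediate_value_Icc hk.1.le hcont
    ⟨periodIntegral_zero.le.trans hy.le, hky⟩
  refine ⟨x, ⟨hx.1.lt_of_ne ?_, hx.2.trans_lt hk.2⟩, rfl⟩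
  rintro rfl
  exact hy.ne' periodIntegral_zero

/-- The squared amplitude for which the normalized distance between zeros is `y`. -/
def sqAmplitude : ℝ → ℝ := Function.invFunOn periodIntegral (Ioo 0 1)

lemma sqAmplitude_mem {y : ℝ} (hy : Real.pi / √2 < y) : sqAmplitude y ∈ Ioo (0 : ℝ) 1 :=
  Function.invFunOn_mem (exists_periodIntegral_eq hy)

lemma periodIntegral_sqAmplitude {y : ℝ} (hy : Real.pi / √2 < y) :
    periodIntegral (sqAmplitude y) = y :=
  Function.invFunOn_eq (exists_periodIntegral_eq hy)

lemma sqAmplitude_periodIntegral {k : ℝ} (hk : k ∈ Ioo (0 : ℝ) 1) :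
    sqAmplitude (periodIntegral k) = k := by
  have hinj : InjOn periodIntegral (Ioo 0 1) :=
    strictMonoOn_periodIntegral.injOn.mono Ioo_subset_Iio_self
  exact hinj.leftInvOn_invFunOn hk

lemma strictMonoOn_sqAmplitude : StrictMonoOn sqAmplitude (Ioi (Real.pi / √2)) := by
  intro x hx y hy hxy
  rwa [← strictMonoOn_periodIntegral.lt_iff_lt (sqAmplitude_mem hx).2 (sqAmplitude_mem hy).2,
    periodIntegral_sqAmplitude hx, periodIntegral_sqAmplitude hy]

lemma continuousAt_sqAmplitude {y : ℝ} (hy : Real.pi / √2 < y) : ContinuousAt sqAmplitude y := by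
  refine strictMonoOn_sqAmplitude.continuousAt_of_image_mem_nhds (Ioi_mem_nhds hy)
    (mem_of_superset (isOpen_Ioo.mem_nhds (sqAmplitude_mem hy)) fun k hk => ?_)
  refine ⟨periodIntegral k, ?_, sqAmplitude_periodIntegral hk⟩
  rw [mem_Ioi, ← periodIntegral_zero]
  exact strictMonoOn_periodIntegral (by simp) hk.2 hk.1

lemma hasDerivAt_sqAmplitude {y : ℝ} (hy : Real.pi / √2 < y) :
    HasDerivAt sqAmplitude (periodIntegralDeriv (sqAmplitude y))⁻¹ y :=
  (hasDerivAt_periodIntegral (sqAmplitude_mem hy).2).of_local_left_inverse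
    (continuousAt_sqAmplitude hy) (periodIntegralDeriv_pos (sqAmplitude_mem hy).2).ne'
    (by filter_upwards [Ioi_mem_nhds hy] with x hx using periodIntegral_sqAmplitude hx)

/-- The factors `T'(k)` cancel, so a second differentiation needs only the first derivative of the
amplitude. -/
lemma hasDerivAt_energyIntegral_sqAmplitude {y : ℝ} (hy : Real.pi / √2 < y) :
    HasDerivAt (fun y => energyIntegral (sqAmplitude y)) ((1 - sqAmplitude y) ^ 2) y := by
  refine ((hasDerivAt_energyIntegral (sqAmplitude_mem hy).2).comp y
    (hasDerivAt_sqAmplitude hy)).congr_deriv ?_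
  have := (periodIntegralDeriv_pos (sqAmplitude_mem hy).2).ne'
  field_simp

lemma halfPeriod_eq (ε k : ℝ) : halfPeriod ε k = √2 * ε * periodIntegral k := by
  rw [halfPeriod, phaseTime, periodIntegral, ← intervalIntegral.integral_const_mul]
  simp only [mul_one_div]

/-- Substitution `s = phaseTime ε k θ`, where the profile is `√k sin θ`. -/
lemma integral_profile {ε k : ℝ} (hε : 0 < ε) (hk : 0 ≤ k) (hk1 : k < 1) :
    ∫ s in (0 : ℝ)..halfPeriod ε k, (1 - profile ε k s ^ 4) / (4 * ε) =
      √2 / 4 * energyIntegral k := by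
  have hc := (continuous_iff_continuousAt.2 fun s => (hasDerivAt_profile hε hk hk1 s).continuousAt)
  have h := intervalIntegral.integral_comp_mul_deriv (a := 0) (b := Real.pi)
    (f := phaseTime ε k) (g := fun s => (1 - profile ε k s ^ 4) / (4 * ε))
    (fun θ _ => hasDerivAt_phaseTime hk hk1 θ) (continuous_speed_inv hk hk1).continuousOn
    (by fun_prop)
  rw [phaseTime_zero] at h
  rw [halfPeriod, ← h, energyIntegral, ← intervalIntegral.integral_const_mul]
  refine intervalIntegral.integral_congr fun θ _ => ?_
  have e4 : √k ^ 4 = k ^ 2 := by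
    rw [show √k ^ 4 = (√k ^ 2) ^ 2 by ring, Real.sq_sqrt hk]
  simp only [Function.comp, profile, phase_phaseTime hε hk hk1, mul_pow, e4]
  field_simp

/-! ### The least energy as a function of the length -/

/-- The half wave of the Allen-Cahn equation with distance `ℓ` between its zeros. -/
def halfWave (ε ℓ : ℝ) : ℝ → ℝ := profile ε (sqAmplitude (ℓ / (√2 * ε)))

/-- The least energy on an interval of length `ℓ` with zero boundary values. -/
def leastEnergy (ε ℓ : ℝ) : ℝ := √2 / 4 * energyIntegral (sqAmplitude (ℓ / (√2 * ε)))

/-- The derivative of the least energy in the length of the interval. -/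
def leastEnergyDeriv (ε ℓ : ℝ) : ℝ := (1 - sqAmplitude (ℓ / (√2 * ε))) ^ 2 / (4 * ε)

/-- The second derivative of the least energy in the length of the interval. -/
def leastEnergyDeriv₂ (ε ℓ : ℝ) : ℝ :=
  -((1 - sqAmplitude (ℓ / (√2 * ε))) /
    (2 * √2 * ε ^ 2 * periodIntegralDeriv (sqAmplitude (ℓ / (√2 * ε)))))

section HalfWave

variable {ε ℓ : ℝ}

lemma pi_div_sqrt_two_lt (hε : 0 < ε) (hℓ : ε * Real.pi < ℓ) :
    Real.pi / √2 < ℓ / (√2 * ε) := by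
  rw [div_lt_div_iff₀ (by positivity) (by positivity)]
  nlinarith [Real.sqrt_pos.2 (show (0 : ℝ) < 2 by norm_num)]

lemma halfPeriod_sqAmplitude (hε : 0 < ε) (hℓ : ε * Real.pi < ℓ) :
    halfPeriod ε (sqAmplitude (ℓ / (√2 * ε))) = ℓ := by
  rw [halfPeriod_eq, periodIntegral_sqAmplitude (pi_div_sqrt_two_lt hε hℓ)]
  have : √2 * ε ≠ 0 := by positivity
  field_simp

lemma isHalfWave_halfWave (hε : 0 < ε) (hℓ : ε * Real.pi < ℓ) :
    IsHalfWave ε ℓ (halfWave ε ℓ) := by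
  have hk := sqAmplitude_mem (pi_div_sqrt_two_lt hε hℓ)
  have := isHalfWave_profile hε hk.1 hk.2
  rwa [halfPeriod_sqAmplitude hε hℓ] at this

lemma integral_halfWave (hε : 0 < ε) (hℓ : ε * Real.pi < ℓ) :
    ∫ s in (0 : ℝ)..ℓ, (1 - halfWave ε ℓ s ^ 4) / (4 * ε) = leastEnergy ε ℓ := by
  have hk := sqAmplitude_mem (pi_div_sqrt_two_lt hε hℓ)
  have := integral_profile hε hk.1.le hk.2
  rwa [halfPeriod_sqAmplitude hε hℓ] at this

lemma hasDerivAt_leastEnergy (hε : 0 < ε) (hℓ : ε * Real.pi < ℓ) :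
    HasDerivAt (leastEnergy ε) (leastEnergyDeriv ε ℓ) ℓ := by
  refine (((hasDerivAt_energyIntegral_sqAmplitude (pi_div_sqrt_two_lt hε hℓ)).comp ℓ
    ((hasDerivAt_id ℓ).div_const (√2 * ε))).const_mul (√2 / 4)).congr_deriv ?_
  rw [leastEnergyDeriv]
  field_simp

lemma hasDerivAt_leastEnergyDeriv (hε : 0 < ε) (hℓ : ε * Real.pi < ℓ) :
    HasDerivAt (leastEnergyDeriv ε) (leastEnergyDeriv₂ ε ℓ) ℓ := by
  have hy := pi_div_sqrt_two_lt hε hℓ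
  have hp := (periodIntegralDeriv_pos (sqAmplitude_mem hy).2).ne'
  refine (((((hasDerivAt_sqAmplitude hy).comp ℓ
    ((hasDerivAt_id ℓ).div_const (√2 * ε))).const_sub 1).pow 2).div_const (4 * ε)).congr_deriv ?_
  rw [leastEnergyDeriv₂]
  simp only [Function.comp, id]
  field_simp
  norm_num
  ring

/-- Strict concavity: a longer interval carries a larger amplitude, and `(1 - k)²` decreases in `k`
on `(0, 1)`. -/
lemma leastEnergyDeriv₂_neg (hε : 0 < ε) (hℓ : ε * Real.pi < ℓ) :
    leastEnergyDeriv₂ ε ℓ < 0 := by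
  have hk := sqAmplitude_mem (pi_div_sqrt_two_lt hε hℓ)
  have hp := periodIntegralDeriv_pos hk.2
  have := sub_pos.2 hk.2
  exact neg_neg_iff_pos.2 (by positivity)

end HalfWave

/-! ### Partitions by moving nodes -/

section Nodes

variable {p : ℕ}

lemma node_zero (p : ℕ) : node p 0 = 0 := by simp [node]

lemma node_eq_mul (p i : ℕ) : node p i = i * node p 1 := by
  simp only [node, Nat.cast_one]
  ring

lemma node_succ (p i : ℕ) : node p (i + 1) = node p i + node p 1 := by
  rw [node_eq_mul p (i + 1), node_eq_mul p i]
  push_cast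
  ring

lemma node_two_mul (hp : 0 < p) : node p (2 * p) = 1 := by
  have : (p : ℝ) ≠ 0 := by positivity
  simp only [node, Nat.cast_mul, Nat.cast_ofNat]
  exact div_self (by positivity)

lemma movingNode_zero (p : ℕ) (f : UnitAddCircle → ℝ) : movingNode p f 0 = node p := by
  funext i
  simp [movingNode]

lemma movingNode_succ_sub (p : ℕ) (f : UnitAddCircle → ℝ) (t : ℝ) (i : ℕ) :
    movingNode p f t (i + 1) - movingNode p f t i =
      node p 1 + (f (node p (i + 1) : UnitAddCircle) - f (node p i : UnitAddCircle)) * t := by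
  rw [movingNode, movingNode, node_succ]
  ring

lemma isPartition_movingNode (hp : 0 < p) {f : UnitAddCircle → ℝ} {t : ℝ}
    (ht : ∀ i < 2 * p, 0 < node p 1 +
      (f (node p (i + 1) : UnitAddCircle) - f (node p i : UnitAddCircle)) * t) :
    IsPartition (2 * p) (movingNode p f t) where
  lt_succ i hi := by
    rw [← sub_pos, movingNode_succ_sub]
    exact ht i hi
  period := by
    -- The nodes of index `0` and `2p` are the same point of the circle, so `f` moves both equally
    -- and the partition still closes after one turn.
    have : ((1 : ℝ) : UnitAddCircle) = ((0 : ℝ) : UnitAddCircle) := by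
      rw [AddCircle.coe_period]; rfl
    simp only [movingNode, node_two_mul hp, node_zero, this]
    ring

lemma isPartition_node (hp : 0 < p) : IsPartition (2 * p) (node p) := by
  have h1 : 0 < node p 1 := by unfold node; positivity
  simpa [movingNode_zero] using
    isPartition_movingNode hp (f := 0) (t := 0) (fun i _ => by simpa using h1)

lemma movingDomain_eq (p : ℕ) (f : UnitAddCircle → ℝ) (t : ℝ) :
    movingDomain p f t = arcUnion (movingNode p f t) (IsPartition.evens (2 * p)) := by
  ext x
  simp only [movingDomain, arcUnion, mem_iUnion, Finset.mem_range, Finset.mem_filter, exists_prop]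
  constructor
  · rintro ⟨j, hj, hx⟩
    exact ⟨2 * j, ⟨by omega, even_two_mul j⟩, hx⟩
  · rintro ⟨i, ⟨hi, he⟩, hx⟩
    obtain ⟨j, rfl⟩ := even_iff_two_dvd.1 he
    exact ⟨j, by omega, hx⟩

end Nodes

/-! ### The symmetric solution with equally spaced zeros -/

section SymmetricTransition

variable {ε : ℝ} {p : ℕ} {w : ℝ → ℝ}

lemma IsHalfWave.periodic (hp : 0 < p) (hw : IsHalfWave ε (node p 1) w) :
    Function.Periodic w 1 := by
  intro s
  have := hw.add_nat_mul s (2 * p)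
  rwa [← node_eq_mul, node_two_mul hp, (even_two_mul p).neg_one_pow, one_mul] at this

/-- The broken phase transition at the nodes is the periodic continuation of the half wave. -/
lemma symmetricTransition_coe (hp : 0 < p) (hw : IsHalfWave ε (node p 1) w) (s : ℝ) :
    (bumpSum (node p) (fun _ => w) (IsPartition.evens (2 * p)) -
      bumpSum (node p) (fun _ => w) (IsPartition.odds (2 * p))) (s : UnitAddCircle) = w s := by
  have hq := isPartition_node hp
  have hu : ∀ i < 2 * p, IsHalfWave ε (node p (i + 1) - node p i) w := fun i _ => by
    rwa [node_succ, add_sub_cancel_left]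
  obtain ⟨i, hi, r, hr, hrs⟩ := hq.exists_coe_eq (s : UnitAddCircle)
  obtain ⟨n, rfl⟩ := exists_int_add_of_coe_eq hrs.symm
  have hn : w (r + n) = w r := by
    simpa using (hw.periodic hp).int_mul n r
  rw [← hrs, hq.bumpSum_sub_bumpSum_coe (u := fun _ => w) hu hi (Ico_subset_Icc_self hr), hn,
    ← hw.add_nat_mul, ← node_eq_mul, sub_add_cancel]

lemma exists_node_add (hp : 0 < p) (x : UnitAddCircle) :
    ∃ i < 2 * p, ∃ s ∈ Ico 0 (node p 1), ((node p i + s : ℝ) : UnitAddCircle) = x := by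
  obtain ⟨i, hi, r, hr, hrs⟩ := (isPartition_node hp).exists_coe_eq x
  rw [node_succ] at hr
  exact ⟨i, hi, r - node p i, ⟨by linarith [hr.1], by linarith [hr.2]⟩, by
    rw [add_sub_cancel, hrs]⟩

lemma arcUnion_node_singleton (p : ℕ) : arcUnion (node p) {0} = arc 0 (node p 1) := by
  simp [arcUnion, node_zero]

/-- Uniqueness on the single arc of index `0` forces the half wave there; the alternating signs
agree with `w (s + L) = -w s`, so the reflected copies continue `w` smoothly. -/
lemma isSymmetricTransition_iff (hp : 0 < p) (hε : 0 < ε) (hw : IsHalfWave ε (node p 1) w)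
    (u : UnitAddCircle → ℝ) :
    IsSymmetricTransition ε p u ↔ ∀ s : ℝ, u (s : UnitAddCircle) = w s := by
  have hq := isPartition_node hp
  have hu : ∀ i < 2 * p, IsHalfWave ε (node p (i + 1) - node p i) w := fun i _ => by
    rwa [node_succ, add_sub_cancel_left]
  have hS : ∀ i ∈ ({0} : Finset ℕ), i < 2 * p := by simpa using hp
  have hval : ∀ s ∈ Icc 0 (node p 1),
      bumpSum (node p) (fun _ => w) {0} (s : UnitAddCircle) = w s := fun s hs => by
    have := hq.bumpSum_coe (u := fun _ => w) hu hS (i := 0) (by simp) (s := s)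
      (by simpa [node_zero] using hs)
    simpa [node_zero] using this
  constructor
  · rintro ⟨v, ⟨hv, hpos⟩, hval'⟩ s
    rw [← arcUnion_node_singleton] at hv hpos
    have hvw := hq.eq_bumpSum_of_pos (u := fun _ => w) hε hu hS hv hpos
    obtain ⟨i, hi, r, hr, hrs⟩ := exists_node_add hp (s : UnitAddCircle)
    obtain ⟨n, rfl⟩ := exists_int_add_of_coe_eq hrs.symm
    have hn : w (node p i + r + n) = w (node p i + r) := by
      simpa using (hw.periodic hp).int_mul n (node p i + r)
    rw [← hrs, hval' i hi r (Ico_subset_Icc_self hr), hvw, hval r (Ico_subset_Icc_self hr), hn,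
      add_comm, node_eq_mul p i, hw.add_nat_mul]
  · intro h
    refine ⟨bumpSum (node p) (fun _ => w) {0}, ⟨?_, ?_⟩, fun i _ s hs => ?_⟩
    · rw [← arcUnion_node_singleton]
      exact hq.isDirichletMinimizer_bumpSum (u := fun _ => w) hε hu hS
    · rw [← arcUnion_node_singleton]
      exact fun x hx => hq.bumpSum_pos (u := fun _ => w) hu hS hx
    · rw [h, hval s hs, add_comm, node_eq_mul p i, hw.add_nat_mul]

variable {u : UnitAddCircle → ℝ}

lemma circleDeriv_coe_of_lift (h : ∀ s : ℝ, u (s : UnitAddCircle) = w s) (s : ℝ) :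
    circleDeriv u (s : UnitAddCircle) = deriv w s := by
  rw [circleDeriv_coe, funext h]

lemma isAllenCahnSolution_of_lift (hε : 0 < ε) {L : ℝ} (hw : IsHalfWave ε L w)
    (h : ∀ s : ℝ, u (s : UnitAddCircle) = w s) : IsAllenCahnSolution ε u := by
  refine ⟨by rw [funext h]; exact hw.contDiff, fun x => ?_⟩
  obtain ⟨s, rfl⟩ := QuotientAddGroup.mk_surjective x
  have h1 : circleDeriv (circleDeriv u) (s : UnitAddCircle) = deriv (deriv w) s :=
    circleDeriv_coe_of_lift (circleDeriv_coe_of_lift h) s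
  have h2 : HasDerivAt doubleWell (w s ^ 3 - w s) (w s) := by
    refine (((((hasDerivAt_id (w s)).pow 2).const_sub 1).pow 2).div_const 4).congr_deriv ?_
    simp
    ring
  refine (congrArg (ε ^ 2 * ·) h1).trans ?_
  refine Eq.trans ?_ (congrArg (deriv doubleWell) (h s).symm)
  rw [h2.deriv, hw.deriv_deriv]
  field_simp

lemma zeroSet_eq_nodeSet (hp : 0 < p) (hw : IsHalfWave ε (node p 1) w)
    (h : ∀ s : ℝ, u (s : UnitAddCircle) = w s) : {x | u x = 0} = nodeSet p := by
  ext x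
  constructor
  · intro hx
    obtain ⟨i, hi, s, hs, rfl⟩ := exists_node_add hp x
    refine ⟨i, hi, ?_⟩
    rw [mem_ofPred_eq, h, add_comm, node_eq_mul p i, hw.add_nat_mul] at hx
    rcases hs.1.eq_or_lt with rfl | h0
    · rw [add_zero]
    · have := (hw.pos s ⟨h0, hs.2⟩).ne'
      simp_all
  · rintro ⟨i, _, rfl⟩
    rw [mem_ofPred_eq, h, ← zero_add (node p i), node_eq_mul p i, hw.add_nat_mul, hw.apply_zero,
      mul_zero]

end SymmetricTransition

/-! ### First and second variation of the balanced energy -/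

section Variation

variable {ε : ℝ} {p : ℕ}

lemma isHalfWave_movingNode (hε : 0 < ε) {f : UnitAddCircle → ℝ} {t : ℝ}
    (ht : ∀ i < 2 * p, ε * Real.pi < node p 1 +
      (f (node p (i + 1) : UnitAddCircle) - f (node p i : UnitAddCircle)) * t) :
    ∀ i < 2 * p, IsHalfWave ε (movingNode p f t (i + 1) - movingNode p f t i)
      (halfWave ε (movingNode p f t (i + 1) - movingNode p f t i)) := fun i hi =>
  isHalfWave_halfWave hε (by rw [movingNode_succ_sub]; exact ht i hi)

/-- Finitely many open conditions in `t`, involving only the values of `f` at the nodes; no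
regularity of `f` is needed. -/
lemma eventually_lt_gap (hL : ε * Real.pi < node p 1) (f : UnitAddCircle → ℝ) :
    ∀ᶠ t in 𝓝 (0 : ℝ), ∀ i < 2 * p, ε * Real.pi < node p 1 +
      (f (node p (i + 1) : UnitAddCircle) - f (node p i : UnitAddCircle)) * t := by
  have : ∀ i ∈ Finset.range (2 * p), ∀ᶠ t in 𝓝 (0 : ℝ), ε * Real.pi < node p 1 +
      (f (node p (i + 1) : UnitAddCircle) - f (node p i : UnitAddCircle)) * t := fun i _ => by
    have hc : Continuous fun t : ℝ => node p 1 +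
      (f (node p (i + 1) : UnitAddCircle) - f (node p i : UnitAddCircle)) * t := by fun_prop
    exact hc.continuousAt.eventually_const_lt (by simpa using hL)
  filter_upwards [(Filter.eventually_all_finset _).2 this] with t ht i hi
  exact ht i (Finset.mem_range.2 hi)

lemma balancedEnergy_movingDomain (hp : 0 < p) (hε : 0 < ε) {f : UnitAddCircle → ℝ} {t : ℝ}
    (ht : ∀ i < 2 * p, ε * Real.pi < node p 1 +
      (f (node p (i + 1) : UnitAddCircle) - f (node p i : UnitAddCircle)) * t) :
    balancedEnergy ε (movingDomain p f t) = ∑ i ∈ Finset.range (2 * p), leastEnergy ε (node p 1 +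
      (f (node p (i + 1) : UnitAddCircle) - f (node p i : UnitAddCircle)) * t) := by
  have hπ : 0 < ε * Real.pi := by positivity
  have hq := isPartition_movingNode hp fun i hi => hπ.trans (ht i hi)
  rw [movingDomain_eq, hq.balancedEnergy_eq hε (isHalfWave_movingNode hε ht)]
  refine Finset.sum_congr rfl fun i hi => ?_
  rw [movingNode_succ_sub]
  exact integral_halfWave hε (ht i (Finset.mem_range.1 hi))

lemma existsUnique_isBrokenPhaseTransition (hp : 0 < p) (hε : 0 < ε) {f : UnitAddCircle → ℝ}
    {t : ℝ} (ht : ∀ i < 2 * p, ε * Real.pi < node p 1 +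
      (f (node p (i + 1) : UnitAddCircle) - f (node p i : UnitAddCircle)) * t) :
    ∃! U, IsBrokenPhaseTransition ε (movingDomain p f t) U := by
  have hπ : 0 < ε * Real.pi := by positivity
  have hq := isPartition_movingNode hp fun i hi => hπ.trans (ht i hi)
  have hiff := hq.isBrokenPhaseTransition_iff hε (isHalfWave_movingNode hε ht)
  rw [movingDomain_eq]
  exact ⟨_, (hiff _).2 rfl, fun U hU => (hiff U).1 hU⟩

lemma hasDerivAt_balancedEnergy (hp : 0 < p) (hε : 0 < ε) (hL : ε * Real.pi < node p 1)
    (f : UnitAddCircle → ℝ) : ∀ᶠ t in 𝓝 (0 : ℝ),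
      HasDerivAt (fun t => balancedEnergy ε (movingDomain p f t))
        (∑ i ∈ Finset.range (2 * p), leastEnergyDeriv ε (node p 1 +
          (f (node p (i + 1) : UnitAddCircle) - f (node p i : UnitAddCircle)) * t) *
          (f (node p (i + 1) : UnitAddCircle) - f (node p i : UnitAddCircle))) t := by
  -- Differentiating at `t` requires the sum formula on a whole neighbourhood of `t`.
  filter_upwards [(eventually_lt_gap hL f).eventually_nhds] with t ht
  have heq : (fun t => balancedEnergy ε (movingDomain p f t)) =ᶠ[𝓝 t] fun t =>
      ∑ i ∈ Finset.range (2 * p), leastEnergy ε (node p 1 +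
        (f (node p (i + 1) : UnitAddCircle) - f (node p i : UnitAddCircle)) * t) := by
    filter_upwards [ht] with r hr using balancedEnergy_movingDomain hp hε hr
  refine HasDerivAt.congr_of_eventuallyEq (HasDerivAt.fun_sum fun i hi => ?_) heq
  have hlin : HasDerivAt (fun t : ℝ => node p 1 +
      (f (node p (i + 1) : UnitAddCircle) - f (node p i : UnitAddCircle)) * t)
      (f (node p (i + 1) : UnitAddCircle) - f (node p i : UnitAddCircle)) t := by
    simpa using ((hasDerivAt_id t).const_mul
      (f (node p (i + 1) : UnitAddCircle) - f (node p i : UnitAddCircle))).const_add (node p 1)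
  have h := (hasDerivAt_leastEnergy hε (ht.self_of_nhds i (Finset.mem_range.1 hi))).comp t hlin
  exact h

/-- Affine gaps contribute no second-order term of their own, and at `t = 0` all gaps coincide, so
one common factor comes out of the sum. -/
lemma hasDerivAt_deriv_balancedEnergy (hp : 0 < p) (hε : 0 < ε) (hL : ε * Real.pi < node p 1)
    (f : UnitAddCircle → ℝ) :
    HasDerivAt (deriv fun t => balancedEnergy ε (movingDomain p f t))
      (leastEnergyDeriv₂ ε (node p 1) * ∑ i ∈ Finset.range (2 * p),
        (f (node p i : UnitAddCircle) - f (node p (i + 1) : UnitAddCircle)) ^ 2) 0 := by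
  have heq := (hasDerivAt_balancedEnergy hp hε hL f).mono fun t ht => ht.deriv
  rw [Finset.mul_sum]
  refine HasDerivAt.congr_of_eventuallyEq (HasDerivAt.fun_sum fun i hi => ?_) heq
  have hlin : HasDerivAt (fun t : ℝ => node p 1 +
      (f (node p (i + 1) : UnitAddCircle) - f (node p i : UnitAddCircle)) * t)
      (f (node p (i + 1) : UnitAddCircle) - f (node p i : UnitAddCircle)) 0 := by
    simpa using ((hasDerivAt_id (0 : ℝ)).const_mul
      (f (node p (i + 1) : UnitAddCircle) - f (node p i : UnitAddCircle))).const_add (node p 1)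
  have h0 := hasDerivAt_leastEnergyDeriv hε hL
  rw [← add_zero (node p 1), ← mul_zero (f (node p (i + 1) : UnitAddCircle) -
    f (node p i : UnitAddCircle))] at h0
  refine ((h0.comp (0 : ℝ) hlin).mul_const _).congr_deriv ?_
  rw [mul_zero, add_zero]
  ring

end Variation

end CircleAllenCahn

end

theorem mainTheorem9 (p : ℕ) (hp : 0 < p) :
    ∃ v : ℝ → ℝ, ∀ ε : ℝ, 0 < ε → ε < 1 / (2 * (p : ℝ) * Real.pi) →
      v ε < 0 ∧
      ∃ u : UnitAddCircle → ℝ,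
        -- `u` is the symmetric solution with nodes `i / (2p)`, and `c = u_x(0) > 0`
        CircleAllenCahn.IsSymmetricTransition ε p u ∧
        (∀ u', CircleAllenCahn.IsSymmetricTransition ε p u' → u' = u) ∧
        CircleAllenCahn.IsAllenCahnSolution ε u ∧
        {x | u x = 0} = CircleAllenCahn.nodeSet p ∧
        0 < CircleAllenCahn.circleDeriv u 0 ∧
        ∀ f : UnitAddCircle → ℝ,
          -- the balanced energy of the moving nodes is well defined for small times,
          -- and `u` is the broken phase transition at time zero
          (∀ᶠ t in 𝓝 (0 : ℝ), ∃! U, CircleAllenCahn.IsBrokenPhaseTransition ε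
            (CircleAllenCahn.movingDomain p f t) U) ∧
          CircleAllenCahn.IsBrokenPhaseTransition ε (CircleAllenCahn.movingDomain p f 0) u ∧
          -- second variation
          (∀ᶠ t in 𝓝 (0 : ℝ), DifferentiableAt ℝ
            (fun t => CircleAllenCahn.balancedEnergy ε (CircleAllenCahn.movingDomain p f t)) t) ∧
          HasDerivAt
            (deriv fun t =>
              CircleAllenCahn.balancedEnergy ε (CircleAllenCahn.movingDomain p f t))
            (ε * CircleAllenCahn.circleDeriv u 0 ^ 2 * v ε *
              ∑ i ∈ Finset.range (2 * p),
                (f (CircleAllenCahn.node p i : UnitAddCircle)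
                  - f (CircleAllenCahn.node p (i + 1) : UnitAddCircle)) ^ 2) 0 ∧
          deriv (deriv fun t =>
            CircleAllenCahn.balancedEnergy ε (CircleAllenCahn.movingDomain p f t)) 0 ≤ 0 := by
  -- `v` is `e''(1/(2p))` normalized by `ε c²`, so that the prefactor in the formula cancels; it
  -- depends on `ε` and `p` only.
  refine ⟨fun ε => CircleAllenCahn.leastEnergyDeriv₂ ε (CircleAllenCahn.node p 1) /
    (ε * deriv (CircleAllenCahn.halfWave ε (CircleAllenCahn.node p 1)) 0 ^ 2), fun ε hε hεp => ?_⟩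
  have hp' : (0 : ℝ) < p := by exact_mod_cast hp
  -- The bound on `ε` is the existence threshold `επ < 1/(2p)` for half waves.
  have hL : ε * Real.pi < CircleAllenCahn.node p 1 := by
    rw [lt_div_iff₀ (by positivity)] at hεp
    rw [CircleAllenCahn.node, Nat.cast_one, lt_div_iff₀ (by positivity)]
    linarith
  have hw := CircleAllenCahn.isHalfWave_halfWave hε hL
  have hneg := CircleAllenCahn.leastEnergyDeriv₂_neg hε hL
  have hlift := CircleAllenCahn.symmetricTransition_coe hp hw
  set u := CircleAllenCahn.bumpSum (CircleAllenCahn.node p)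
      (fun _ => CircleAllenCahn.halfWave ε (CircleAllenCahn.node p 1))
      (CircleAllenCahn.IsPartition.evens (2 * p)) -
    CircleAllenCahn.bumpSum (CircleAllenCahn.node p)
      (fun _ => CircleAllenCahn.halfWave ε (CircleAllenCahn.node p 1))
      (CircleAllenCahn.IsPartition.odds (2 * p)) with hu
  have hc : CircleAllenCahn.circleDeriv u 0 =
      deriv (CircleAllenCahn.halfWave ε (CircleAllenCahn.node p 1)) 0 :=
    CircleAllenCahn.circleDeriv_coe_of_lift hlift 0
  have hc0 := hw.deriv_zero_pos
  have hsym := CircleAllenCahn.isSymmetricTransition_iff hp hε hw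
  have hv : ε * CircleAllenCahn.circleDeriv u 0 ^ 2 *
      (CircleAllenCahn.leastEnergyDeriv₂ ε (CircleAllenCahn.node p 1) /
        (ε * deriv (CircleAllenCahn.halfWave ε (CircleAllenCahn.node p 1)) 0 ^ 2)) =
      CircleAllenCahn.leastEnergyDeriv₂ ε (CircleAllenCahn.node p 1) := by
    rw [hc]
    exact mul_div_cancel₀ _ (by positivity)
  refine ⟨div_neg_of_neg_of_pos hneg (by positivity), u, (hsym u).2 hlift, fun u' hu' => ?_,
    CircleAllenCahn.isAllenCahnSolution_of_lift hε hw hlift,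
    CircleAllenCahn.zeroSet_eq_nodeSet hp hw hlift, by rw [hc]; exact hc0, fun f => ?_⟩
  · funext x
    obtain ⟨s, rfl⟩ := QuotientAddGroup.mk_surjective x
    exact ((hsym u').1 hu' s).trans (hlift s).symm
  have hd2 := CircleAllenCahn.hasDerivAt_deriv_balancedEnergy hp hε hL f
  refine ⟨?_, ?_, ?_, ?_, ?_⟩
  · filter_upwards [CircleAllenCahn.eventually_lt_gap hL f] with t ht
    exact CircleAllenCahn.existsUnique_isBrokenPhaseTransition hp hε ht
  · rw [CircleAllenCahn.movingDomain_eq, CircleAllenCahn.movingNode_zero]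
    refine ((CircleAllenCahn.isPartition_node hp).isBrokenPhaseTransition_iff hε
      (u := fun _ => CircleAllenCahn.halfWave ε (CircleAllenCahn.node p 1)) (fun i _ => ?_) u).2 hu
    rwa [CircleAllenCahn.node_succ, add_sub_cancel_left]
  · exact (CircleAllenCahn.hasDerivAt_balancedEnergy hp hε hL f).mono fun t ht =>
      ht.differentiableAt
  · rwa [hv]
  · rw [hd2.deriv]
    exact mul_nonpos_of_nonpos_of_nonneg hneg.le (Finset.sum_nonneg fun i _ => sq_nonneg _)
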